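/- **Theorem (dual binomial formula).** Let $n\ge 0$, $\mathbb F=\mathbb Q(q,t)$, $\mathbb K=\mathbb Q(q,t,a)$, $\mathcal C_n=(\mathbb Z_{\ge 0})^n$, $x=(x_1,\dots,x_n)$, and $|\alpha|=\alpha_1+\dots+\alpha_n$ for $\alpha\in\mathcal C_n$. For $v\in\mathbb Z^n$ let $\overline v\in\mathbb F^n$ be given by $\overline v_i=q^{v_i}t^{-k_i(v)}$, where $k_i(v)=\#\{k<i\mid v_k\ge v_i\}+\#\{k>i\mid v_k>v_i\}$; put $\widetilde v=\overline{(-v_n,\dots,-v_1)}$ and $\tau=(1,t^{-1},\dots,t^{1-n})$. For $\alpha\in\mathcal C_n$ let $G_\alpha\in\mathbb F[x]$ be the unique polynomial of degree at most $|\alpha|$ such that the coefficient of $x^\alpha$ in $G_\alpha$ is $1$ and $G_\alpha(\overline\beta)=0$ for all $\beta\in\mathcal C_n$ with $|\beta|\le|\alpha|$, $\beta\ne\alpha$. Let $G'_\alpha\in\mathbb F[x]$ be the unique polynomial of degree at most $|\alpha|$ which has the same homogeneous part of degree $|\alpha|$ as $G_\alpha$ and satisfies $G'_\alpha(\widetilde\beta)=0$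 for all $\beta\in\mathcal C_n$ with $|\beta|<|\alpha|$. (These polynomials exist and are unique, and $G_\alpha(\overline\alpha)$, $G_\alpha(a\tau)$ and $G'_\alpha(a^{-1}\tau)$ are nonzero.) Define, in $\mathbb K[x]$ and $\mathbb F$ respectively, $$K_\alpha(x)=\frac{G_\alpha(x)}{G_\alpha(a\tau)},\qquad K'_\alpha(x)=\frac{G'_\alpha(x)}{G'_\alpha(a^{-1}\tau)},\qquad \begin{bmatrix}\alpha\\ \beta\end{bmatrix}_{q,t}=\frac{G_\beta(\overline\alpha)}{G_\beta(\overline\beta)},\qquad \tau_\beta=(-1)^{|\beta|}q^{n'(\beta)}t^{-n(\beta^+)}.$$ Here $\beta^+$ is the nonincreasing rearrangement of $\beta$, and $$n'(\beta)=\sum_{i=1}^n\sum_{j=1}^{\beta_i}(\beta_i-j),\qquad n(\beta)=\sum_{i=1}^n\sum_{j=1}^{\beta_i}\Bigl(\#\{k>i\mid j\le\beta_k\le\beta_i\}+\#\{k<i\mid j\le\beta_k+1\le\beta_i\}\Bigr).$$ Then for every $\alpha\in\mathcal C_n$ one has, in $\mathbb K[x]$, $$K'_\alpha(x)=\sum_{\beta\in\mathcal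 C_n}\tau_\beta\begin{bmatrix}\alpha\\ \beta\end{bmatrix}_{q,t}K_\beta(ax),$$ where only finitely many terms of the sum are nonzero. -/

import Mathlib

noncomputable section

namespace InterpolationMacdonald

open MvPolynomial

/-- The field `ℚ(q, t)`. -/
abbrev BaseField : Type := FractionRing (MvPolynomial (Fin 2) ℚ)

/-- The field `ℚ(q, t, a)`, as rational functions in `a` over `ℚ(q, t)`. -/
abbrev BigField : Type := RatFunc BaseField

/-- The indeterminate `q` of `ℚ(q, t)`. -/
def qVar : BaseField := algebraMap (MvPolynomial (Fin 2) ℚ) BaseField (X 0)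

/-- The indeterminate `t` of `ℚ(q, t)`. -/
def tVar : BaseField := algebraMap (MvPolynomial (Fin 2) ℚ) BaseField (X 1)

/-- The indeterminate `a` of `ℚ(q, t, a)`. -/
def aVar : BigField := RatFunc.X

/-- `|α| = α₁ + ⋯ + αₙ`. -/
def size {n : ℕ} (α : Fin n → ℕ) : ℕ := ∑ i, α i

/-- `k_i(v) = #{k < i | v_k ≥ v_i} + #{k > i | v_k > v_i}`. -/
def kStat {n : ℕ} (v : Fin n → ℤ) (i : Fin n) : ℕ :=
  (Finset.univ.filter fun k : Fin n => k < i ∧ v i ≤ v k).card +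
    (Finset.univ.filter fun k : Fin n => i < k ∧ v i < v k).card

/-- The spectral vector `v̄`, with `v̄_i = q ^ (v_i) t ^ (-k_i(v))`. -/
def bar {k : Type*} [Field k] (q t : k) {n : ℕ} (v : Fin n → ℤ) : Fin n → k :=
  fun i => q ^ v i * (t ^ kStat v i)⁻¹

/-- The point `ᾱ` for a composition `α`. -/
def barC {k : Type*} [Field k] (q t : k) {n : ℕ} (α : Fin n → ℕ) : Fin n → k :=
  bar q t fun i => (α i : ℤ)

/-- The point `α̃`, which is the spectral vector of `-w₀ α = (-αₙ, …, -α₁)`. -/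
def tildeC {k : Type*} [Field k] (q t : k) {n : ℕ} (α : Fin n → ℕ) : Fin n → k :=
  bar q t fun i => -(α (Fin.rev i) : ℤ)

/-- The vector `τ = (1, t⁻¹, …, t ^ (1 - n))`. -/
def tauVec {k : Type*} [Field k] (t : k) (n : ℕ) : Fin n → k :=
  fun i => (t ^ (i : ℕ))⁻¹

/-- The defining properties of the interpolation polynomial `G_α(x; q, t)`: degree at most `|α|`,
vanishing at `β̄` for all `β ≠ α` with `|β| ≤ |α|`, and coefficient `1` at `x ^ α`. -/
def IsInterpolation {k : Type*} [Field k] (q t : k) {n : ℕ} (α : Fin n → ℕ)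
    (p : MvPolynomial (Fin n) k) : Prop :=
  p.totalDegree ≤ size α ∧
    (∀ β : Fin n → ℕ, size β ≤ size α → β ≠ α → eval (barC q t β) p = 0) ∧
    coeff (Finsupp.equivFunOnFinite.symm α) p = 1

/-- The interpolation polynomial `G_α(x; q, t)`. -/
def G {k : Type*} [Field k] (q t : k) {n : ℕ} (α : Fin n → ℕ) : MvPolynomial (Fin n) k :=
  Classical.epsilon (IsInterpolation q t α)

/-- The defining properties of the primed interpolation polynomial `G'_α(x; q, t)`: degree at most
`|α|`, the same homogeneous part of degree `|α|` as `G_α`, and vanishing at `β̃` for all `β` with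
`|β| < |α|`. -/
def IsPrimedInterpolation {k : Type*} [Field k] (q t : k) {n : ℕ} (α : Fin n → ℕ)
    (p : MvPolynomial (Fin n) k) : Prop :=
  p.totalDegree ≤ size α ∧
    homogeneousComponent (size α) p = homogeneousComponent (size α) (G q t α) ∧
    ∀ β : Fin n → ℕ, size β < size α → eval (tildeC q t β) p = 0

/-- The primed interpolation polynomial `G'_α(x; q, t)`. -/
def GPrime {k : Type*} [Field k] (q t : k) {n : ℕ} (α : Fin n → ℕ) : MvPolynomial (Fin n) k :=
  Classical.epsilon (IsPrimedInterpolation q t α)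

/-- The generalized binomial coefficient `G_β(ᾱ) / G_β(β̄)`. -/
def binom {k : Type*} [Field k] (q t : k) {n : ℕ} (α β : Fin n → ℕ) : k :=
  eval (barC q t α) (G q t β) / eval (barC q t β) (G q t β)

/-- The nonincreasing rearrangement `α⁺` of `α`. -/
def decr {n : ℕ} (α : Fin n → ℕ) : Fin n → ℕ := fun i => α (Tuple.sort α (Fin.rev i))

/-- The leg length `l(s)` of the box `s = (i, j)` of `α`. -/
def leg {n : ℕ} (α : Fin n → ℕ) (i : Fin n) (j : ℕ) : ℕ :=
  (Finset.univ.filter fun k : Fin n => i < k ∧ j ≤ α k ∧ α k ≤ α i).card +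
    (Finset.univ.filter fun k : Fin n => k < i ∧ j ≤ α k + 1 ∧ α k + 1 ≤ α i).card

/-- `n(α)`, the sum of the leg lengths of the boxes `(i, j)`, `1 ≤ j ≤ α_i`. -/
def nStat {n : ℕ} (α : Fin n → ℕ) : ℕ := ∑ i, ∑ j ∈ Finset.Icc 1 (α i), leg α i j

/-- `n'(α)`, the sum of the arm lengths `α_i - j` of the boxes `(i, j)`, `1 ≤ j ≤ α_i`. -/
def nStatPrime {n : ℕ} (α : Fin n → ℕ) : ℕ := ∑ i, ∑ j ∈ Finset.Icc 1 (α i), (α i - j)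

/-- `τ_α = (-1) ^ |α| q ^ n'(α) t ^ (-n(α⁺))`. -/
def tauC {k : Type*} [Field k] (q t : k) {n : ℕ} (α : Fin n → ℕ) : k :=
  (-1) ^ size α * q ^ nStatPrime α * (t ^ nStat (decr α))⁻¹

/-- `G_α(x; q, t)`, regarded as a polynomial with coefficients in `ℚ(q, t, a)`. -/
def GBig {n : ℕ} (α : Fin n → ℕ) : MvPolynomial (Fin n) BigField :=
  map (algebraMap BaseField BigField) (G qVar tVar α)

/-- `G'_α(x; q, t)`, regarded as a polynomial with coefficients in `ℚ(q, t, a)`. -/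
def GPrimeBig {n : ℕ} (α : Fin n → ℕ) : MvPolynomial (Fin n) BigField :=
  map (algebraMap BaseField BigField) (GPrime qVar tVar α)

/-- The value `G_α(a τ)`. -/
def GNorm {n : ℕ} (α : Fin n → ℕ) : BigField :=
  eval (fun i => aVar * tauVec (algebraMap BaseField BigField tVar) n i) (GBig α)

/-- The value `G'_α(a⁻¹ τ)`. -/
def GPrimeNorm {n : ℕ} (α : Fin n → ℕ) : BigField :=
  eval (fun i => aVar⁻¹ * tauVec (algebraMap BaseField BigField tVar) n i) (GPrimeBig α)

/-- The normalized polynomial `K_α(x) = G_α(x) / G_α(a τ)`. -/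
def KPoly {n : ℕ} (α : Fin n → ℕ) : MvPolynomial (Fin n) BigField :=
  C (GNorm α)⁻¹ * GBig α

/-- The normalized primed polynomial `K'_α(x) = G'_α(x) / G'_α(a⁻¹ τ)`. -/
def KPrimePoly {n : ℕ} (α : Fin n → ℕ) : MvPolynomial (Fin n) BigField :=
  C (GPrimeNorm α)⁻¹ * GPrimeBig α

/-- The substitution `p(x) ↦ p(a x)`. -/
def dilate {n : ℕ} (p : MvPolynomial (Fin n) BigField) : MvPolynomial (Fin n) BigField :=
  aeval (fun i => C aVar * X i) p

/-- The term `τ_β [α over β]_{q,t} K_β(a x)` of the dual binomial formula. -/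
def dualTerm {n : ℕ} (α β : Fin n → ℕ) : MvPolynomial (Fin n) BigField :=
  C (algebraMap BaseField BigField (tauC qVar tVar β * binom qVar tVar α β)) * dilate (KPoly β)

end InterpolationMacdonald

end

/-! A polynomial of degree at most `d` is determined by its coefficients in degree `d` and its
values at the spectral vectors `γ̄` with `|γ| < d`. Indeed, once denominators are cleared, `t = 1`
turns these vectors into a grid, where the combinatorial Nullstellensatz applies; a determinant that
is nonzero after specialization is nonzero.

Given this, the formula follows from two facts, by induction on `|α|`. The first is duality
(`IsGeneric.duality`): `K'_α(a⁻¹γ̄)` is symmetric in `α` and `γ`. At `x = a⁻¹γ̄` the right side is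
the sum of `τ_β G_β(ᾱ) G_β(γ̄) / (G_β(β̄) G_β(aτ))`, which is symmetric too, so for `|γ| < |α|` the
values agree by the formula for `γ`. The second is `G_α(aτ) = τ_α a^|α| G'_α(a⁻¹τ)`
(`IsGeneric.normalization`), which makes the top components agree.

Both facts rest on affine Hecke symmetry. The operators `T_i` act on values at spectral vectors by
mixing `v` with `s_i v`, so they mix `G_α` with `G_{s_i α}`, and `G'_α` with `G'_{s_i α}` by the
same coefficients, because the top components coincide. Raising operators send `α` to `(α_2, …, α_n,
α_1 + 1)`; they are tied to the `T_i` by the eigenvalue equations `IsGeneric.cherednik_G` and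
`IsGeneric.cherednik_GPrime`. At multiples of `τ` each `T_i` acts by the scalar `t`, so both
normalizations obey explicit recursions starting from `α = 0`.

For duality, the action of an operator on the index of `K'_α` is compared with the action of an
operator on the point of evaluation. In this sense `T_i` is its own adjoint, and the raising
operator of the `G'_α` is adjoint to `p ↦ (x_1 - 1) p(x_2, …, x_n, q x_1)`. Symmetry is clear at `α
= 0` and propagates along adjoint pairs. -/

noncomputable section

namespace InterpolationMacdonald

open MvPolynomial

/-! ### Polynomials of bounded degree as coefficient vectors -/

section Monomials

variable {R : Type*} [CommRing R] {n : ℕ}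

/-- The exponent vector of a composition. -/
abbrev expo (α : Fin n → ℕ) : Fin n →₀ ℕ := Finsupp.equivFunOnFinite.symm α

theorem degree_expo (α : Fin n → ℕ) : (expo α).degree = size α := by
  simp [Finsupp.degree_eq_sum, size, expo]

theorem degree_eq_size (d : Fin n →₀ ℕ) : d.degree = size (d : Fin n → ℕ) := by
  simp [Finsupp.degree_eq_sum, size]

theorem expo_coe (d : Fin n →₀ ℕ) : expo (d : Fin n → ℕ) = d := by
  ext; simp [expo]

theorem coeff_eq_zero_of_size {p : MvPolynomial (Fin n) R} {d : ℕ} (hp : p.totalDegree ≤ d)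
    {α : Fin n → ℕ} (hα : d < size α) : coeff (expo α) p = 0 := by
  apply coeff_eq_zero_of_totalDegree_lt
  exact lt_of_le_of_lt hp (hα.trans_eq (degree_expo α).symm)

theorem totalDegree_le_of_coeff {p : MvPolynomial (Fin n) R} {d : ℕ}
    (h : ∀ α : Fin n → ℕ, d < size α → coeff (expo α) p = 0) : p.totalDegree ≤ d := by
  refine Finset.sup_le fun e he => ?_
  by_contra hlt
  have := degree_expo (e : Fin n → ℕ)
  rw [expo_coe] at this
  refine mem_support_iff.1 he ?_
  rw [← expo_coe e]
  exact h _ ((not_le.1 hlt).trans_eq this)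

/-- The compositions of size at most `d`. -/
abbrev Bounded (n d : ℕ) : Type := {α : Fin n → ℕ // size α ≤ d}

theorem le_size (α : Fin n → ℕ) (i : Fin n) : α i ≤ size α :=
  Finset.single_le_sum (f := α) (fun _ _ => Nat.zero_le _) (Finset.mem_univ i)

instance (n d : ℕ) : Finite (Bounded n d) := by
  apply Set.Finite.to_subtype (s := {α : Fin n → ℕ | size α ≤ d})
  exact (Set.finite_Iic (fun _ : Fin n => d)).subset fun α hα i => (le_size α i).trans hα

instance (n d : ℕ) : Fintype (Bounded n d) := Fintype.ofFinite _

/-- The polynomial with prescribed coefficients in degree at most `d`. -/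
def ofCoeffs {d : ℕ} (v : Bounded n d → R) : MvPolynomial (Fin n) R :=
  ∑ γ, monomial (expo γ.1) (v γ)

theorem coeff_ofCoeffs {d : ℕ} (v : Bounded n d → R) (β : Bounded n d) :
    coeff (expo β.1) (ofCoeffs v) = v β := by
  classical
  simp [ofCoeffs, coeff_sum, coeff_monomial, Subtype.coe_inj]

theorem totalDegree_ofCoeffs {d : ℕ} (v : Bounded n d → R) : (ofCoeffs v).totalDegree ≤ d := by
  refine totalDegree_finsetSum_le fun γ _ => (totalDegree_monomial_le _ _).trans ?_
  exact (degree_expo γ.1).trans_le γ.2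

theorem ofCoeffs_coeff {d : ℕ} {p : MvPolynomial (Fin n) R} (hp : p.totalDegree ≤ d) :
    ofCoeffs (fun γ : Bounded n d => coeff (expo γ.1) p) = p := by
  ext e
  rw [← expo_coe e]
  by_cases h : size (e : Fin n → ℕ) ≤ d
  · exact coeff_ofCoeffs _ ⟨_, h⟩
  · rw [coeff_eq_zero_of_size (totalDegree_ofCoeffs _) (not_le.1 h),
      coeff_eq_zero_of_size hp (not_le.1 h)]

theorem eval_ofCoeffs {d : ℕ} (v : Bounded n d → R) (x : Fin n → R) :
    eval x (ofCoeffs v) = ∑ γ, v γ * ∏ i, x i ^ γ.1 i := by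
  simp [ofCoeffs, eval_monomial, Finsupp.prod_fintype]

end Monomials

/-! ### Unisolvence of the interpolation problems -/

section Unisolvence

/-- A polynomial of degree at most `d` which vanishes on a grid of points indexed by the
compositions of size at most `d` is zero; at some compositions of size `d`, vanishing of the value
may be replaced by vanishing of the coefficient. -/
theorem eq_zero_of_grid {R : Type*} [CommRing R] [IsDomain R] {n d : ℕ} {r : ℕ → R}
    (hr : Set.InjOn r (Set.Iic d)) {B : Set (Fin n → ℕ)} (hB : ∀ β ∈ B, size β = d)
    {p : MvPolynomial (Fin n) R} (hp : p.totalDegree ≤ d)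
    (hcoeff : ∀ β ∈ B, coeff (expo β) p = 0)
    (heval : ∀ β, size β ≤ d → β ∉ B → eval (fun i => r (β i)) p = 0) : p = 0 := by
  classical
  by_contra hp0
  obtain ⟨e, he, hdeg⟩ : ∃ e ∈ p.support, p.totalDegree = e.degree :=
    Finset.exists_mem_eq_sup _ (support_nonempty.2 hp0) _
  have hed : e.degree ≤ d := hdeg ▸ hp
  have hei (i : Fin n) : e i ≤ d :=
    (le_size (e : Fin n → ℕ) i).trans ((degree_eq_size e).symm.trans_le hed)
  -- The exponent `e` has maximal degree, and the `i`-th side of the grid has `e i + 1` points, so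
  -- some grid point `r ∘ b` with `b ≤ e` is not a zero of `p`.
  obtain ⟨s, hs, hs0⟩ := combinatorial_nullstellensatz_exists_eval_nonzero p e
    (mem_support_iff.1 he) hdeg (fun i => (Finset.Iic (e i)).image r) fun i => by
      rw [Finset.card_image_of_injOn]
      · simp
      · exact hr.mono fun x hx => (Finset.mem_Iic.1 hx).trans (hei i)
  choose b hb hbs using fun i => Finset.mem_image.1 (hs i)
  have hble : size b ≤ size (e : Fin n → ℕ) :=
    Finset.sum_le_sum fun i _ => Finset.mem_Iic.1 (hb i)
  rw [← degree_eq_size] at hble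
  have hsb : s = fun i => r (b i) := funext fun i => (hbs i).symm
  have hbB : b ∈ B := by
    by_contra hbB
    exact hs0 (hsb ▸ heval b (hble.trans hed) hbB)
  -- Since `b` lies in `B`, it has size `d`; with `b ≤ e` and `e.degree ≤ d` this forces equality in
  -- every entry.
  have hbe : b = e := by
    have h1 : ∑ i, b i = ∑ i, e i := by
      have h2 := hB b hbB
      have h3 := degree_eq_size e
      simp only [size] at *
      omega
    funext i
    exact (Finset.sum_eq_sum_iff_of_le fun i _ => Finset.mem_Iic.1 (hb i)).1 h1 i
      (Finset.mem_univ i)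
  refine mem_support_iff.1 he ?_
  rw [← expo_coe e, ← hbe]
  exact hcoeff b hbB

/-- The matrix of the interpolation problem with values prescribed off `B` and coefficients
prescribed on `B`. -/
def interpMatrix {R : Type*} [CommRing R] {n : ℕ} (d : ℕ) (B : Set (Fin n → ℕ))
    (y : (Fin n → ℕ) → Fin n → R) : Matrix (Bounded n d) (Bounded n d) R :=
  open Classical in
  .of fun β γ => if β.1 ∈ B then (if γ = β then 1 else 0) else ∏ i, y β.1 i ^ γ.1 i

theorem interpMatrix_mulVec_of_mem {R : Type*} [CommRing R] {n d : ℕ} {B : Set (Fin n → ℕ)}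
    (y : (Fin n → ℕ) → Fin n → R) (v : Bounded n d → R) {β : Bounded n d} (hβ : β.1 ∈ B) :
    (interpMatrix d B y).mulVec v β = coeff (expo β.1) (ofCoeffs v) := by
  simp [interpMatrix, Matrix.mulVec, dotProduct, hβ, coeff_ofCoeffs]

theorem interpMatrix_mulVec_of_notMem {R : Type*} [CommRing R] {n d : ℕ} {B : Set (Fin n → ℕ)}
    (y : (Fin n → ℕ) → Fin n → R) (v : Bounded n d → R) {β : Bounded n d} (hβ : β.1 ∉ B) :
    (interpMatrix d B y).mulVec v β = eval (y β.1) (ofCoeffs v) := by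
  simp [interpMatrix, Matrix.mulVec, dotProduct, hβ, eval_ofCoeffs, mul_comm]

theorem ofCoeffs_eq_zero_iff {R : Type*} [CommRing R] {n d : ℕ} {v : Bounded n d → R} :
    ofCoeffs v = 0 ↔ v = 0 := by
  refine ⟨fun h => funext fun β => ?_, fun h => by simp [h, ofCoeffs]⟩
  rw [← coeff_ofCoeffs v β, h]
  simp

theorem interpMatrix_map {R S : Type*} [CommRing R] [CommRing S] (φ : R →+* S) {n : ℕ} (d : ℕ)
    (B : Set (Fin n → ℕ)) (y : (Fin n → ℕ) → Fin n → R) :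
    φ.mapMatrix (interpMatrix d B y) = interpMatrix d B fun β i => φ (y β i) := by
  ext β γ
  by_cases h : β.1 ∈ B <;> by_cases h' : γ = β <;> simp [interpMatrix, h, h']

/-- Vanishing of polynomials can be tested on points which specialize to a grid. -/
theorem eq_zero_of_specialization {A R k : Type*} [CommRing A] [IsDomain A] [CommRing R]
    [IsDomain R] [Field k] {ψ : A →+* k} (hψ : Function.Injective ψ) (φ : A →+* R) {n d : ℕ}
    {r : ℕ → R}
    (hr : Set.InjOn r (Set.Iic d)) {B : Set (Fin n → ℕ)} (hB : ∀ β ∈ B, size β = d)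
    {y : (Fin n → ℕ) → Fin n → A} (hy : ∀ β i, size β ≤ d → φ (y β i) = r (β i))
    {p : MvPolynomial (Fin n) k} (hp : p.totalDegree ≤ d)
    (hcoeff : ∀ β ∈ B, coeff (expo β) p = 0)
    (heval : ∀ β, size β ≤ d → β ∉ B → eval (fun i => ψ (y β i)) p = 0) : p = 0 := by
  classical
  by_contra hp0
  rw [← ofCoeffs_coeff hp] at hp0 hcoeff heval
  set v := fun γ : Bounded n d => coeff (expo γ.1) p
  -- The coefficient vector of a nonzero solution lies in the kernel, so the determinant vanishes
  -- over `k`. By injectivity of `ψ` it vanishes over `A`, hence also after `φ`, where the grid case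
  -- excludes it.
  have h1 : (ψ.mapMatrix (interpMatrix d B y)).det = 0 := by
    rw [← Matrix.exists_mulVec_eq_zero_iff, interpMatrix_map]
    refine ⟨v, mt ofCoeffs_eq_zero_iff.2 hp0, funext fun β => ?_⟩
    by_cases h : β.1 ∈ B
    · rw [interpMatrix_mulVec_of_mem _ _ h, hcoeff _ h, Pi.zero_apply]
    · rw [interpMatrix_mulVec_of_notMem _ _ h, heval _ β.2 h, Pi.zero_apply]
  rw [← RingHom.map_det, map_eq_zero_iff ψ hψ] at h1
  have h2 : (φ.mapMatrix (interpMatrix d B y)).det = 0 := by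
    rw [← RingHom.map_det, h1, map_zero]
  rw [← Matrix.exists_mulVec_eq_zero_iff, interpMatrix_map] at h2
  obtain ⟨w, hw0, hw⟩ := h2
  refine hw0 (ofCoeffs_eq_zero_iff.1 (eq_zero_of_grid hr hB (totalDegree_ofCoeffs w) ?_ ?_))
  · intro β hβ
    have := congrFun hw ⟨β, (hB β hβ).le⟩
    rwa [interpMatrix_mulVec_of_mem _ _ hβ] at this
  · intro β hβd hβ
    have := congrFun hw ⟨β, hβd⟩
    rw [interpMatrix_mulVec_of_notMem _ _ hβ] at this
    simpa only [hy β _ hβd, Pi.zero_apply] using this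

/-- Uniqueness in an interpolation problem implies existence. -/
theorem exists_interpolant {k : Type*} [Field k] {n d : ℕ} {B : Set (Fin n → ℕ)}
    {z : (Fin n → ℕ) → Fin n → k}
    (h : ∀ p : MvPolynomial (Fin n) k, p.totalDegree ≤ d →
      (∀ β ∈ B, size β ≤ d → coeff (expo β) p = 0) →
      (∀ β, size β ≤ d → β ∉ B → eval (z β) p = 0) → p = 0) (f : (Fin n → ℕ) → k) :
    ∃ p : MvPolynomial (Fin n) k, p.totalDegree ≤ d ∧
      (∀ β ∈ B, size β ≤ d → coeff (expo β) p = f β) ∧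
      ∀ β, size β ≤ d → β ∉ B → eval (z β) p = f β := by
  classical
  -- The matrix is square, so injectivity, which is uniqueness, gives surjectivity, which is
  -- existence.
  have hinj : Function.Injective (interpMatrix d B z).mulVecLin := by
    rw [← LinearMap.ker_eq_bot, LinearMap.ker_eq_bot']
    intro v hv
    refine ofCoeffs_eq_zero_iff.1 (h _ (totalDegree_ofCoeffs v) ?_ ?_)
    · intro β hβ hβd
      have := congrFun hv ⟨β, hβd⟩
      rwa [Matrix.mulVecLin_apply, interpMatrix_mulVec_of_mem _ _ hβ] at this
    · intro β hβd hβ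
      have := congrFun hv ⟨β, hβd⟩
      rwa [Matrix.mulVecLin_apply, interpMatrix_mulVec_of_notMem _ _ hβ] at this
  obtain ⟨v, hv⟩ := LinearMap.injective_iff_surjective.1 hinj fun β => f β.1
  refine ⟨ofCoeffs v, totalDegree_ofCoeffs v, ?_, ?_⟩
  · intro β hβ hβd
    rw [← congrFun hv ⟨β, hβd⟩, Matrix.mulVecLin_apply, interpMatrix_mulVec_of_mem _ _ hβ]
  · intro β hβd hβ
    rw [← congrFun hv ⟨β, hβd⟩, Matrix.mulVecLin_apply, interpMatrix_mulVec_of_notMem _ _ hβ]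

end Unisolvence

/-! ### Dilation of the variables -/

section Scale

variable {R : Type*} [CommRing R] {n : ℕ}

/-- The substitution `p(x) ↦ p(c x)`. -/
def scale (c : R) : MvPolynomial (Fin n) R →ₐ[R] MvPolynomial (Fin n) R :=
  aeval fun i => C c * X i

theorem eval_scale (c : R) (x : Fin n → R) (p : MvPolynomial (Fin n) R) :
    eval x (scale c p) = eval (fun i => c * x i) p := by
  have : (eval x).comp (scale c).toRingHom = eval fun i => c * x i := by
    ext <;> simp [scale]
  exact congrArg (· p) this

theorem coeff_scale (c : R) (p : MvPolynomial (Fin n) R) (e : Fin n →₀ ℕ) :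
    coeff e (scale c p) = c ^ e.degree * coeff e p := by
  classical
  induction p using MvPolynomial.induction_on' with
  | monomial u a =>
    have : scale c (monomial u a) = monomial u (c ^ u.degree * a) := by
      rw [scale, aeval_monomial]
      simp only [mul_pow]
      rw [Finsupp.prod_fintype _ _ (by simp), Finset.prod_mul_distrib, monomial_eq,
        Finsupp.prod_fintype _ _ (by simp), Finset.prod_pow_eq_pow_sum, Finsupp.degree_eq_sum]
      simp only [map_mul, map_pow, algebraMap_eq]
      ring
    rw [this, coeff_monomial, coeff_monomial]
    split_ifs with h
    · rw [h]
    · simp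
  | add p q hp hq => rw [map_add, coeff_add, coeff_add, hp, hq, mul_add]

theorem totalDegree_scale_le (c : R) (p : MvPolynomial (Fin n) R) :
    (scale c p).totalDegree ≤ p.totalDegree :=
  totalDegree_le_of_support_subset fun e he => by
    rw [mem_support_iff, coeff_scale] at he
    exact mem_support_iff.2 (right_ne_zero_of_mul he)

theorem homogeneousComponent_scale (c : R) (p : MvPolynomial (Fin n) R) (d : ℕ) :
    homogeneousComponent d (scale c p) = C (c ^ d) * homogeneousComponent d p := by
  ext e
  rw [coeff_homogeneousComponent, coeff_C_mul, coeff_homogeneousComponent, coeff_scale]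
  split_ifs with h
  · rw [h]
  · simp

theorem scale_injective {k : Type*} [Field k] {c : k} (hc : c ≠ 0) {p : MvPolynomial (Fin n) k}
    (h : scale c p = 0) : p = 0 := by
  ext e
  have := congrArg (coeff e) h
  rw [coeff_scale, coeff_zero] at this
  exact (mul_eq_zero.1 this).resolve_left (pow_ne_zero _ hc)

end Scale

section

/-! ### Generic parameters, existence and uniqueness of the interpolation polynomials -/

section Generic

variable {k : Type*} [Field k]

/-- `q` and `t` are algebraically independent over `ℚ`. -/
def IsGeneric (q t : k) : Prop :=
  ∃ ψ : MvPolynomial (Fin 2) ℚ →+* k, Function.Injective ψ ∧ ψ (X 0) = q ∧ ψ (X 1) = t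

namespace IsGeneric

variable {q t : k}

theorem q_ne_zero (h : IsGeneric q t) : q ≠ 0 := by
  obtain ⟨ψ, hψ, rfl, -⟩ := h
  exact (map_ne_zero_iff ψ hψ).2 (X_ne_zero 0)

theorem t_ne_zero (h : IsGeneric q t) : t ≠ 0 := by
  obtain ⟨ψ, hψ, -, rfl⟩ := h
  exact (map_ne_zero_iff ψ hψ).2 (X_ne_zero 1)

theorem pow_mul_pow_inj (h : IsGeneric q t) {a b c d : ℕ}
    (he : q ^ a * t ^ b = q ^ c * t ^ d) : a = c ∧ b = d := by
  obtain ⟨ψ, hψ, rfl, rfl⟩ := h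
  have h1 : (X 0 ^ a * X 1 ^ b : MvPolynomial (Fin 2) ℚ) = X 0 ^ c * X 1 ^ d :=
    hψ (by simpa using he)
  simp only [X_pow_eq_monomial, monomial_mul, one_mul] at h1
  have h2 := (monomial_left_inj one_ne_zero).1 h1
  have h3 := DFunLike.congr_fun h2 0
  have h4 := DFunLike.congr_fun h2 1
  simp at h3 h4
  exact ⟨h3, h4⟩

theorem zpow_mul_zpow_eq_one (h : IsGeneric q t) {a b : ℤ}
    (he : q ^ a * t ^ b = 1) : a = 0 ∧ b = 0 := by
  have hq := h.q_ne_zero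
  have ht := h.t_ne_zero
  have h1 : q ^ a.toNat * t ^ b.toNat = q ^ (-a).toNat * t ^ (-b).toNat := by
    have ha : a = (a.toNat : ℤ) - ((-a).toNat : ℤ) := by omega
    have hb : b = (b.toNat : ℤ) - ((-b).toNat : ℤ) := by omega
    rw [ha, hb, zpow_sub₀ hq, zpow_sub₀ ht] at he
    simp only [zpow_natCast] at he
    field_simp at he
    simpa using he
  have := h.pow_mul_pow_inj h1
  omega

theorem monomial_inj (h : IsGeneric q t) {a b c d : ℤ}
    (he : q ^ a * t ^ b = q ^ c * t ^ d) : a = c ∧ b = d := by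
  have hq := h.q_ne_zero
  have ht := h.t_ne_zero
  have : q ^ (a - c) * t ^ (b - d) = 1 := by
    rw [zpow_sub₀ hq, zpow_sub₀ ht]
    have h1 := zpow_ne_zero c hq
    have h2 := zpow_ne_zero d ht
    field_simp
    exact he
  have := h.zpow_mul_zpow_eq_one this
  omega

theorem bar_eq {n : ℕ} (v : Fin n → ℤ) (i : Fin n) :
    bar q t v i = q ^ v i * t ^ (-(kStat v i : ℤ)) := by
  rw [bar, zpow_neg, zpow_natCast]

theorem bar_ne_zero (h : IsGeneric q t) {n : ℕ} (v : Fin n → ℤ) (i : Fin n) : bar q t v i ≠ 0 :=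
  mul_ne_zero (zpow_ne_zero _ h.q_ne_zero) (inv_ne_zero (pow_ne_zero _ h.t_ne_zero))

end IsGeneric

/-- The two counted sets are disjoint. The uniform bound lets one factor `t ^ n` clear the
denominators in `t` of all spectral vectors. -/
theorem kStat_le {n : ℕ} (v : Fin n → ℤ) (i : Fin n) : kStat v i ≤ n := by
  rw [kStat, ← Finset.card_union_of_disjoint]
  · exact (Finset.card_le_univ _).trans_eq (Fintype.card_fin n)
  · rw [Finset.disjoint_left]
    intro x hx hx'
    simp only [Finset.mem_filter] at hx hx'
    exact lt_asymm hx.2.1 hx'.2.1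

/-- Unisolvence for spectral vectors `q ^ (s β_i) t ^ (-k)` with `s = ± 1`. -/
theorem IsGeneric.eq_zero_of_eval {q t : k} (h : IsGeneric q t) {n d : ℕ} {s : ℤ}
    (hs : s = 1 ∨ s = -1)
    {z : (Fin n → ℕ) → Fin n → k} {m : (Fin n → ℕ) → Fin n → ℕ} (hm : ∀ β i, m β i ≤ n)
    (hz : ∀ β i, z β i = q ^ (s * β i) * (t ^ m β i)⁻¹)
    {B : Set (Fin n → ℕ)} (hB : ∀ β ∈ B, size β = d)
    {p : MvPolynomial (Fin n) k} (hp : p.totalDegree ≤ d)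
    (hcoeff : ∀ β ∈ B, coeff (expo β) p = 0)
    (heval : ∀ β, size β ≤ d → β ∉ B → eval (z β) p = 0) : p = 0 := by
  have hq := h.q_ne_zero
  have ht := h.t_ne_zero
  obtain ⟨ψ, hψ, hψq, hψt⟩ := h
  -- Multiplying the points by `c` makes all exponents of `q` and `t` nonnegative for `size β ≤ d`,
  -- so the coordinates come from `ℚ[q, t]`. Then `t = 1` gives the grid `r`.
  let c : k := q ^ d * t ^ n
  have hc : c ≠ 0 := mul_ne_zero (pow_ne_zero _ hq) (pow_ne_zero _ ht)
  let r : ℕ → MvPolynomial (Fin 2) ℚ := fun j => X 0 ^ (d + s * j).toNat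
  let y : (Fin n → ℕ) → Fin n → MvPolynomial (Fin 2) ℚ :=
    fun β i => X 0 ^ (d + s * β i).toNat * X 1 ^ (n - m β i)
  refine scale_injective (inv_ne_zero hc) (eq_zero_of_specialization hψ
    (φ := (aeval ![X 0, 1] : MvPolynomial (Fin 2) ℚ →ₐ[ℚ] MvPolynomial (Fin 2) ℚ).toRingHom)
    (d := d) (r := r) (y := y) ?_ hB ?_ ((totalDegree_scale_le _ _).trans hp) ?_ ?_)
  · intro i hi j hj hij
    simp only [r, X_pow_eq_monomial] at hij
    have := DFunLike.congr_fun ((monomial_left_inj one_ne_zero).1 hij) 0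
    simp only [Finsupp.single_eq_same, Set.mem_Iic] at this hi hj
    rcases hs with rfl | rfl <;> omega
  · intro β i _
    simp [y, r]
  · intro β hβ
    rw [coeff_scale, hcoeff β hβ, mul_zero]
  · intro β hβd hβ
    rw [eval_scale, ← heval β hβd hβ]
    congr 2
    funext i
    -- Even for `s = -1` nothing is truncated, since `β i ≤ size β ≤ d`.
    have h1 : ((d + s * β i).toNat : ℤ) = d + s * β i := by
      have := le_size β i
      rcases hs with rfl | rfl <;> omega
    have h2 : t ^ n = t ^ (n - m β i) * t ^ m β i := by
      rw [← pow_add, Nat.sub_add_cancel (hm β i)]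
    have h3 : q ^ (d + s * β i).toNat = q ^ d * q ^ (s * β i) := by
      rw [← zpow_natCast, h1, zpow_add₀ hq, zpow_natCast]
    rw [hz]
    simp only [y, map_mul, map_pow, hψq, hψt, c]
    rw [h2, h3]
    field_simp

variable {q t : k} {n : ℕ}

theorem IsGeneric.eq_zero_of_barC (h : IsGeneric q t) {d : ℕ} {B : Set (Fin n → ℕ)}
    (hB : ∀ β ∈ B, size β = d) {p : MvPolynomial (Fin n) k} (hp : p.totalDegree ≤ d)
    (hcoeff : ∀ β ∈ B, coeff (expo β) p = 0)
    (heval : ∀ β, size β ≤ d → β ∉ B → eval (barC q t β) p = 0) : p = 0 :=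
  h.eq_zero_of_eval (Or.inl rfl) (m := fun β i => kStat (fun j => (β j : ℤ)) i)
    (fun _ _ => kStat_le _ _) (fun β i => by simp [barC, bar]) hB hp hcoeff heval

theorem size_rev (β : Fin n → ℕ) : size (fun i => β (Fin.rev i)) = size β :=
  Equiv.sum_comp Fin.revPerm β

/-- Unisolvence with prescribed coefficients in the top degree, and values at the points `β̃`
for the other `β`. -/
theorem IsGeneric.eq_zero_of_tildeC_rev (h : IsGeneric q t) {d : ℕ} {p : MvPolynomial (Fin n) k}
    (hp : p.totalDegree ≤ d) (hcoeff : ∀ β : Fin n → ℕ, size β = d → coeff (expo β) p = 0)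
    (heval : ∀ β, size β < d → eval (tildeC q t fun i => β (Fin.rev i)) p = 0) : p = 0 :=
  h.eq_zero_of_eval (Or.inr rfl) (B := {β | size β = d})
    (z := fun β => tildeC q t fun i => β (Fin.rev i))
    (m := fun β i => kStat (fun j => -(β j : ℤ)) i)
    (fun _ _ => kStat_le _ _) (fun β i => by simp [tildeC, bar]) (fun _ hβ => hβ) hp hcoeff
    fun β hβ hβ' => heval β (lt_of_le_of_ne hβ hβ')

theorem homogeneousComponent_eq_iff {p r : MvPolynomial (Fin n) k} {d : ℕ} :
    homogeneousComponent d p = homogeneousComponent d r ↔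
      ∀ β : Fin n → ℕ, size β = d → coeff (expo β) p = coeff (expo β) r := by
  constructor
  · intro hpr β hβ
    have := congrArg (coeff (expo β)) hpr
    rwa [coeff_homogeneousComponent, coeff_homogeneousComponent, if_pos (by rw [degree_expo, hβ]),
      if_pos (by rw [degree_expo, hβ])] at this
  · intro hpr
    ext e
    rw [coeff_homogeneousComponent, coeff_homogeneousComponent]
    split_ifs with he
    · rw [← expo_coe e]
      exact hpr _ (by rw [← degree_eq_size, he])
    · rfl

theorem IsGeneric.eq_zero_of_tildeC (h : IsGeneric q t) {d : ℕ} {p : MvPolynomial (Fin n) k}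
    (hp : p.totalDegree ≤ d) (htop : homogeneousComponent d p = 0)
    (heval : ∀ β : Fin n → ℕ, size β < d → eval (tildeC q t β) p = 0) : p = 0 := by
  refine h.eq_zero_of_tildeC_rev hp (fun β hβ => ?_) fun β hβ => heval _ (by rwa [size_rev])
  have := homogeneousComponent_eq_iff.1 (htop.trans (map_zero (homogeneousComponent d)).symm) β hβ
  rwa [coeff_zero] at this

theorem IsGeneric.existsUnique_isInterpolation (h : IsGeneric q t) (α : Fin n → ℕ) :
    ∃! p : MvPolynomial (Fin n) k, IsInterpolation q t α p := by
  obtain ⟨p, hp, hp1, hp2⟩ := exists_interpolant (d := size α) (B := {α}) (z := barC q t)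
    (fun p hp h1 h2 => h.eq_zero_of_barC (B := {α}) (by simp) hp
      (fun β hβ => h1 β hβ (by rw [Set.mem_singleton_iff.1 hβ])) h2) (Pi.single α 1)
  refine ⟨p, ⟨hp, fun β hβ hβα => ?_, ?_⟩, fun r ⟨hr, hr2, hr1⟩ => sub_eq_zero.1
    (h.eq_zero_of_barC (d := size α) (B := {α}) (by simp)
      ((totalDegree_sub _ _).trans (max_le hr hp)) ?_ ?_)⟩
  · rw [hp2 β hβ (by simpa using hβα), Pi.single_eq_of_ne hβα]
  · rw [hp1 α rfl le_rfl, Pi.single_eq_same]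
  · rintro _ rfl
    rw [coeff_sub, hr1, hp1 _ rfl le_rfl, Pi.single_eq_same, sub_self]
  · intro β hβ hβα
    rw [map_sub, hr2 β hβ (by simpa using hβα), hp2 β hβ hβα,
      Pi.single_eq_of_ne (by simpa using hβα), sub_self]

theorem IsGeneric.existsUnique_isPrimedInterpolation (h : IsGeneric q t) (α : Fin n → ℕ) :
    ∃! p : MvPolynomial (Fin n) k, IsPrimedInterpolation q t α p := by
  classical
  obtain ⟨p, hp, hp1, hp2⟩ := exists_interpolant (d := size α) (B := {β | size β = size α})
    (z := fun β => tildeC q t fun i => β (Fin.rev i))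
    (fun p hp h1 h2 => h.eq_zero_of_tildeC_rev hp (fun β hβ => h1 β hβ hβ.le)
      fun β hβ => h2 β hβ.le hβ.ne)
    (fun β => if size β = size α then coeff (expo β) (G q t α) else 0)
  have hp3 : homogeneousComponent (size α) p = homogeneousComponent (size α) (G q t α) :=
    homogeneousComponent_eq_iff.2 fun β hβ => by rw [hp1 β hβ hβ.le, if_pos hβ]
  have hp4 (β : Fin n → ℕ) (hβ : size β < size α) : eval (tildeC q t β) p = 0 := by
    have := hp2 (fun i => β (Fin.rev i)) (by rw [size_rev]; exact hβ.le) (by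
      simp only [Set.mem_ofPred_eq, size_rev]; exact hβ.ne)
    rw [size_rev, if_neg hβ.ne] at this
    simpa only [Fin.rev_rev] using this
  refine ⟨p, ⟨hp, hp3, hp4⟩, fun r ⟨hr, hr2, hr1⟩ => sub_eq_zero.1
    (h.eq_zero_of_tildeC ((totalDegree_sub _ _).trans (max_le hr hp)) ?_ ?_)⟩
  · rw [map_sub, hr2, hp3, sub_self]
  · intro β hβ
    rw [map_sub, hr1 β hβ, hp4 β hβ, sub_self]

theorem IsGeneric.isInterpolation_G (h : IsGeneric q t) (α : Fin n → ℕ) :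
    IsInterpolation q t α (G q t α) :=
  Classical.epsilon_spec (h.existsUnique_isInterpolation α).exists

theorem IsGeneric.isPrimedInterpolation_GPrime (h : IsGeneric q t) (α : Fin n → ℕ) :
    IsPrimedInterpolation q t α (GPrime q t α) :=
  Classical.epsilon_spec (h.existsUnique_isPrimedInterpolation α).exists

/-- A zero at `ᾱ` as well would make `G_α` vanish at every spectral vector of size at most `|α|`,
against its coefficient `1`. -/
theorem IsGeneric.eval_G_ne_zero (h : IsGeneric q t) (α : Fin n → ℕ) :
    eval (barC q t α) (G q t α) ≠ 0 := by
  intro h0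
  obtain ⟨h1, h2, h3⟩ := h.isInterpolation_G α
  have : G q t α = 0 := h.eq_zero_of_barC (B := ∅) (by simp) h1 (by simp) fun β hβ _ => by
    by_cases hβα : β = α
    · rw [hβα, h0]
    · exact h2 β hβ hβα
  simp [this] at h3

end Generic

end

section

/-! ### Spectral vectors under adjacent transpositions and affine rotation -/

section SpectralVectors

theorem kStat_eq_sum {n : ℕ} (v : Fin n → ℤ) (i : Fin n) :
    kStat v i = ∑ j, if (j < i ∧ v i ≤ v j) ∨ (i < j ∧ v i < v j) then 1 else 0 := by
  rw [kStat, ← Finset.card_union_of_disjoint, ← Finset.filter_or, Finset.card_filter]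
  rw [Finset.disjoint_left]
  intro x hx hx'
  simp only [Finset.mem_filter] at hx hx'
  exact lt_asymm hx.2.1 hx'.2.1

variable {m : ℕ}

/-- The transposition of two adjacent indices. -/
def adj (i : Fin m) : Equiv.Perm (Fin (m + 1)) := Equiv.swap i.castSucc i.succ

theorem adj_adj (i : Fin m) (j : Fin (m + 1)) : adj i (adj i j) = j := Equiv.swap_apply_self _ _ _

theorem adj_castSucc (i : Fin m) : adj i i.castSucc = i.succ := Equiv.swap_apply_left _ _

theorem adj_succ (i : Fin m) : adj i i.succ = i.castSucc := Equiv.swap_apply_right _ _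

theorem adj_of_ne {i : Fin m} {j : Fin (m + 1)} (h : j ≠ i.castSucc) (h' : j ≠ i.succ) :
    adj i j = j := Equiv.swap_apply_of_ne_of_ne h h'

/-- Without a tie between the two swapped entries, the choice between `≥` and `>` in comparing them
is immaterial, so the statistic just moves with the entries. -/
theorem kStat_comp_adj {v : Fin (m + 1) → ℤ} {i : Fin m} (hv : v i.castSucc ≠ v i.succ)
    (j : Fin (m + 1)) : kStat (v ∘ adj i) j = kStat v (adj i j) := by
  rw [kStat_eq_sum, kStat_eq_sum, ← Equiv.sum_comp (adj i)]
  refine Finset.sum_congr rfl fun l _ => if_congr ?_ rfl rfl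
  simp only [Function.comp_apply, adj_adj]
  have hj : j = i.castSucc ∨ j = i.succ ∨ (j ≠ i.castSucc ∧ j ≠ i.succ) := by tauto
  have hl : l = i.castSucc ∨ l = i.succ ∨ (l ≠ i.castSucc ∧ l ≠ i.succ) := by tauto
  rcases hj with rfl | rfl | ⟨hj, hj'⟩ <;> rcases hl with rfl | rfl | ⟨hl, hl'⟩ <;>
  simp only [adj_castSucc, adj_succ, adj_of_ne, ne_eq, *, not_false_eq_true] <;>
  simp only [Fin.lt_def, Fin.ext_iff, Fin.val_castSucc, Fin.val_succ, ne_eq] at * <;> omega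

theorem kStat_succ_of_eq {v : Fin (m + 1) → ℤ} {i : Fin m} (hv : v i.castSucc = v i.succ) :
    kStat v i.succ = kStat v i.castSucc + 1 := by
  classical
  rw [kStat_eq_sum, kStat_eq_sum, ← Finset.add_sum_erase _ _ (Finset.mem_univ i.castSucc),
    ← Finset.add_sum_erase _ _ (Finset.mem_univ i.castSucc)]
  have hsum : ∑ l ∈ Finset.univ.erase i.castSucc,
      (if (l < i.succ ∧ v i.succ ≤ v l) ∨ (i.succ < l ∧ v i.succ < v l) then 1 else 0) =
      ∑ l ∈ Finset.univ.erase i.castSucc,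
      if (l < i.castSucc ∧ v i.castSucc ≤ v l) ∨ (i.castSucc < l ∧ v i.castSucc < v l)
        then 1 else 0 := by
    refine Finset.sum_congr rfl fun l hl => ?_
    have hl := Finset.ne_of_mem_erase hl
    refine if_congr ?_ rfl rfl
    by_cases hl' : l = i.succ
    · subst hl'
      simp [hv, i.castSucc_lt_succ.le]
    · simp only [Fin.lt_def, Fin.ext_iff, Fin.val_castSucc, Fin.val_succ, ne_eq] at *
      omega
  rw [hsum]
  simp [hv, add_comm]

/-- The affine rotation `(v₁, …, vₙ) ↦ (v₂, …, vₙ, c v₁)`. -/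
def rotate {β : Type*} (c : β → β) (v : Fin (m + 1) → β) : Fin (m + 1) → β :=
  Fin.snoc (α := fun _ => β) (fun i => v i.succ) (c (v 0))

@[simp] theorem rotate_castSucc {β : Type*} (c : β → β) (v : Fin (m + 1) → β) (i : Fin m) :
    rotate c v i.castSucc = v i.succ := Fin.snoc_castSucc (α := fun _ => β) _ _ _

@[simp] theorem rotate_last {β : Type*} (c : β → β) (v : Fin (m + 1) → β) :
    rotate c v (Fin.last m) = c (v 0) := Fin.snoc_last (α := fun _ => β) _ _

/-- The first entry `v 0` was compared by `v i ≤ v 0`; after moving behind the others it is compared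
by `v i < v 0 + 1`, the same condition over the integers. -/
theorem kStat_rotate_castSucc (v : Fin (m + 1) → ℤ) (i : Fin m) :
    kStat (rotate (· + 1) v) i.castSucc = kStat v i.succ := by
  rw [kStat_eq_sum, kStat_eq_sum, Fin.sum_univ_castSucc, Fin.sum_univ_succ, add_comm]
  congr 1
  · refine if_congr ?_ rfl rfl
    simp [Fin.castSucc_lt_last, (Fin.castSucc_lt_last _).le]
  · refine Finset.sum_congr rfl fun l _ => if_congr ?_ rfl rfl
    simp

theorem kStat_rotate_last (v : Fin (m + 1) → ℤ) :
    kStat (rotate (· + 1) v) (Fin.last m) = kStat v 0 := by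
  rw [kStat_eq_sum, kStat_eq_sum, Fin.sum_univ_castSucc, Fin.sum_univ_succ, add_comm]
  congr 1
  · simp
  · refine Finset.sum_congr rfl fun l _ => ?_
    refine if_congr ?_ rfl rfl
    simp [Fin.castSucc_lt_last, Fin.le_last]

variable {k : Type*} [Field k] {q t : k}

theorem bar_comp_adj {v : Fin (m + 1) → ℤ} {i : Fin m} (hv : v i.castSucc ≠ v i.succ) :
    bar q t (v ∘ adj i) = bar q t v ∘ adj i := by
  funext j
  simp [bar, kStat_comp_adj hv]

theorem IsGeneric.bar_castSucc_of_eq (h : IsGeneric q t) {v : Fin (m + 1) → ℤ} {i : Fin m}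
    (hv : v i.castSucc = v i.succ) : bar q t v i.castSucc = t * bar q t v i.succ := by
  have := h.t_ne_zero
  rw [bar, bar, kStat_succ_of_eq hv, hv, pow_succ]
  field_simp

theorem IsGeneric.bar_rotate (h : IsGeneric q t) (v : Fin (m + 1) → ℤ) :
    bar q t (rotate (· + 1) v) = rotate (q * ·) (bar q t v) := by
  funext i
  induction i using Fin.lastCases with
  | last => simp [bar, kStat_rotate_last, zpow_add_one₀ h.q_ne_zero]; ring
  | cast i => simp [bar, kStat_rotate_castSucc]

/-- Equal powers of `q` mean a tie, and a tie changes the power of `t`. This keeps the denominator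
in the action of `T_i` nonzero. -/
theorem IsGeneric.bar_castSucc_ne (h : IsGeneric q t) (v : Fin (m + 1) → ℤ) (i : Fin m) :
    bar q t v i.castSucc ≠ bar q t v i.succ := by
  intro he
  rw [IsGeneric.bar_eq, IsGeneric.bar_eq] at he
  obtain ⟨h1, h2⟩ := h.monomial_inj he
  have := kStat_succ_of_eq h1
  omega

/-- The powers of `q` already differ. This quantity is the numerator of the off-diagonal coefficient
of `T_i`. -/
theorem IsGeneric.bar_castSucc_ne_mul (h : IsGeneric q t) {v : Fin (m + 1) → ℤ} {i : Fin m}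
    (hv : v i.castSucc ≠ v i.succ) : bar q t v i.castSucc - t * bar q t v i.succ ≠ 0 := by
  rw [sub_ne_zero]
  intro he
  rw [IsGeneric.bar_eq, IsGeneric.bar_eq] at he
  refine hv (h.monomial_inj (d := 1 - (kStat v i.succ : ℤ)) (he.trans ?_)).1
  rw [sub_eq_add_neg, zpow_add₀ h.t_ne_zero, zpow_one]
  ring

theorem bar_zero {n : ℕ} : bar q t (0 : Fin n → ℤ) = tauVec t n := by
  funext i
  have : kStat (0 : Fin n → ℤ) i = i := by
    have h : Finset.univ.filter (fun l : Fin n => l < i) = Finset.Iio i := by ext; simp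
    simp [kStat, h]
  simp [bar, tauVec, this]

end SpectralVectors

/-! ### Degree-preserving operators -/

section Graded

variable {k : Type*} [Field k] {n : ℕ}

theorem homogeneousComponent_mul_left {p : MvPolynomial (Fin n) k} {e : ℕ} (hp : p.IsHomogeneous e)
    (r : MvPolynomial (Fin n) k) (d : ℕ) :
    homogeneousComponent (e + d) (p * r) = p * homogeneousComponent d r := by
  let _ : GradedAlgebra (homogeneousSubmodule (Fin n) k) := gradedAlgebra
  have h (s : MvPolynomial (Fin n) k) (j : ℕ) :
      (DirectSum.decompose (homogeneousSubmodule (Fin n) k) s j : MvPolynomial (Fin n) k) =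
        homogeneousComponent j s := decomposition.decompose'_apply s j
  rw [← h, ← h]
  exact DirectSum.coe_decompose_mul_add_of_left_mem (homogeneousSubmodule (Fin n) k) hp

theorem totalDegree_le_iff {p : MvPolynomial (Fin n) k} {d : ℕ} :
    p.totalDegree ≤ d ↔ ∀ e, d < e → homogeneousComponent e p = 0 := by
  refine ⟨fun h e he => homogeneousComponent_eq_zero e p (h.trans_lt he), fun h => ?_⟩
  refine totalDegree_le_of_coeff fun α hα => ?_
  have := homogeneousComponent_eq_iff.1 ((h _ hα).trans (map_zero _).symm) α rfl
  rwa [coeff_zero] at this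

/-- Linear operators which commute with taking homogeneous components. -/
def IsGraded (O : Module.End k (MvPolynomial (Fin n) k)) : Prop :=
  ∀ d p, homogeneousComponent d (O p) = O (homogeneousComponent d p)

theorem IsGraded.mul {O O' : Module.End k (MvPolynomial (Fin n) k)} (h : IsGraded O)
    (h' : IsGraded O') : IsGraded (O * O') := fun d p => by
  rw [Module.End.mul_apply, Module.End.mul_apply, h, h']

theorem isGraded_one : IsGraded (1 : Module.End k (MvPolynomial (Fin n) k)) := fun _ _ => rfl

theorem IsGraded.totalDegree_le {O : Module.End k (MvPolynomial (Fin n) k)} (h : IsGraded O) {d : ℕ}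
    {p : MvPolynomial (Fin n) k} (hp : p.totalDegree ≤ d) : (O p).totalDegree ≤ d :=
  totalDegree_le_iff.2 fun e he => by rw [h, totalDegree_le_iff.1 hp e he, map_zero]

theorem isGraded_aeval {φ : Fin n → MvPolynomial (Fin n) k} (hφ : ∀ i, (φ i).IsHomogeneous 1) :
    IsGraded (aeval φ : MvPolynomial (Fin n) k →ₐ[k] _).toLinearMap := by
  intro d p
  simp only [AlgHom.toLinearMap_apply]
  have h (e : ℕ) : (aeval φ (homogeneousComponent e p)).IsHomogeneous e := by
    simpa using (homogeneousComponent_isHomogeneous e p).aeval φ hφ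
  conv_lhs => rw [← sum_homogeneousComponent p, map_sum, map_sum]
  simp only [homogeneousComponent_of_mem (h _)]
  rw [Finset.sum_ite_eq]
  split_ifs with hd
  · rfl
  · rw [homogeneousComponent_eq_zero d p (by simpa using hd), map_zero]

end Graded

end

section

variable {k : Type*} [Field k] {m : ℕ}

/-! ### Demazure–Lusztig operators and their relations -/

section Hecke

/-- Modulo `x_i - x_{i+1}` the transposition acts trivially. -/
theorem exists_divDiff (i : Fin m) (p : MvPolynomial (Fin (m + 1)) k) :
    ∃ r, p - rename (adj i) p = (X i.castSucc - X i.succ) * r := by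
  have h : (Ideal.Quotient.mkₐ k (Ideal.span {(X i.castSucc - X i.succ :
      MvPolynomial (Fin (m + 1)) k)})).comp (rename (adj i)) = Ideal.Quotient.mkₐ k _ := by
    ext j
    simp only [AlgHom.comp_apply, rename_X, Ideal.Quotient.mkₐ_eq_mk]
    rw [Ideal.Quotient.eq, Ideal.mem_span_singleton]
    by_cases h1 : j = i.castSucc
    · rw [h1, adj_castSucc]
      exact ⟨-1, by ring⟩
    · by_cases h2 : j = i.succ
      · rw [h2, adj_succ]
      · simp [adj_of_ne h1 h2]
  rw [← dvd_def, ← Ideal.mem_span_singleton, ← Ideal.Quotient.eq]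
  exact (AlgHom.congr_fun h p).symm

/-- The divided difference `(p - s_i p) / (x_i - x_{i+1})`. -/
def divDiff (i : Fin m) (p : MvPolynomial (Fin (m + 1)) k) : MvPolynomial (Fin (m + 1)) k :=
  (exists_divDiff i p).choose

theorem divDiff_spec (i : Fin m) (p : MvPolynomial (Fin (m + 1)) k) :
    p - rename (adj i) p = (X i.castSucc - X i.succ) * divDiff i p :=
  (exists_divDiff i p).choose_spec

theorem X_sub_X_ne_zero (i : Fin m) :
    (X i.castSucc - X i.succ : MvPolynomial (Fin (m + 1)) k) ≠ 0 := by
  rw [sub_ne_zero]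
  exact fun h => (Fin.castSucc_lt_succ (i := i)).ne (X_injective h)

variable (t : k)

/-- The Demazure–Lusztig operator
`T_i p = t p - (x_i - t x_{i+1}) (p - s_i p) / (x_i - x_{i+1})`. -/
def hecke (i : Fin m) : Module.End k (MvPolynomial (Fin (m + 1)) k) where
  toFun p := C t * p - (X i.castSucc - C t * X i.succ) * divDiff i p
  map_add' p r := by
    refine mul_left_cancel₀ (X_sub_X_ne_zero i) ?_
    have h1 := divDiff_spec i p
    have h2 := divDiff_spec i r
    have h3 := divDiff_spec i (p + r)
    rw [map_add] at h3
    linear_combination (X i.castSucc - C t * X i.succ) * (h3 - h1 - h2)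
  map_smul' c p := by
    refine mul_left_cancel₀ (X_sub_X_ne_zero i) ?_
    have h1 := divDiff_spec i p
    have h3 := divDiff_spec i (c • p)
    rw [map_smul] at h3
    simp only [smul_eq_C_mul, RingHom.id_apply] at *
    linear_combination (X i.castSucc - C t * X i.succ) * (h3 - C c * h1)

theorem hecke_spec (i : Fin m) (p : MvPolynomial (Fin (m + 1)) k) :
    (X i.castSucc - X i.succ) * hecke t i p =
      (C t - 1) * X i.castSucc * p + (X i.castSucc - C t * X i.succ) * rename (adj i) p := by
  change (X i.castSucc - X i.succ) *
    (C t * p - (X i.castSucc - C t * X i.succ) * divDiff i p) = _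
  linear_combination (X i.castSucc - C t * X i.succ) * divDiff_spec i p

theorem rename_adj_rename_adj (i : Fin m) (p : MvPolynomial (Fin (m + 1)) k) :
    rename (adj i) (rename (adj i) p) = p := by
  rw [rename_rename, show (adj i ∘ adj i : Fin (m + 1) → _) = id from funext (adj_adj i), rename_id]
  rfl

theorem rename_hecke_spec (i : Fin m) (p : MvPolynomial (Fin (m + 1)) k) :
    (X i.succ - X i.castSucc) * rename (adj i) (hecke t i p) =
      (C t - 1) * X i.succ * rename (adj i) p + (X i.succ - C t * X i.castSucc) * p := by
  have := congrArg (rename (adj i)) (hecke_spec t i p)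
  simpa only [map_add, map_mul, map_sub, map_one, rename_X, rename_C, adj_castSucc, adj_succ,
    rename_adj_rename_adj] using this

/-- The quadratic relation `(T_i - t)(T_i + 1) = 0`. Multiplying by `(x_i - x_{i+1})²` removes all
divided differences and leaves an identity in `p` and `s_i p`. -/
theorem hecke_hecke (i : Fin m) (p : MvPolynomial (Fin (m + 1)) k) :
    hecke t i (hecke t i p) = (t - 1) • hecke t i p + t • p := by
  refine mul_left_cancel₀ (mul_ne_zero (X_sub_X_ne_zero i) (X_sub_X_ne_zero i)) ?_
  have h1 := hecke_spec t i (hecke t i p)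
  have h2 := hecke_spec t i p
  have h3 := rename_hecke_spec t i p
  simp only [smul_eq_C_mul, map_sub, map_one]
  linear_combination (X i.castSucc - X i.succ) * h1
    + (C t - 1) * X i.castSucc * h2 - (X i.castSucc - C t * X i.succ) * h3
    - (C t - 1) * (X i.castSucc - X i.succ) * h2

/-- The affine Hecke relation `T_i x_{i+1} T_i = t x_i`; iterated, it carries `x_n` to `x_1`. -/
theorem hecke_X_mul_hecke (i : Fin m) (p : MvPolynomial (Fin (m + 1)) k) :
    hecke t i (X i.succ * hecke t i p) = t • (X i.castSucc * p) := by
  refine mul_left_cancel₀ (mul_ne_zero (X_sub_X_ne_zero i) (X_sub_X_ne_zero i)) ?_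
  have h1 := hecke_spec t i (X i.succ * hecke t i p)
  have h2 := hecke_spec t i p
  have h3 := rename_hecke_spec t i p
  rw [map_mul (rename (adj i)), rename_X, adj_succ] at h1
  simp only [smul_eq_C_mul]
  linear_combination (X i.castSucc - X i.succ) * h1
    + (C t - 1) * X i.castSucc * X i.succ * h2
    - (X i.castSucc - C t * X i.succ) * X i.castSucc * h3

theorem isGraded_hecke (i : Fin m) : IsGraded (hecke t i) := by
  intro d p
  refine mul_left_cancel₀ (X_sub_X_ne_zero i) ?_
  have h1 : (X i.castSucc - X i.succ : MvPolynomial (Fin (m + 1)) k).IsHomogeneous 1 :=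
    (isHomogeneous_X _ _).sub (isHomogeneous_X _ _)
  have h2 : ((C t - 1) * X i.castSucc : MvPolynomial (Fin (m + 1)) k).IsHomogeneous 1 := by
    rw [← C_1, ← C_sub]
    exact isHomogeneous_C_mul_X _ _
  have h3 : (X i.castSucc - C t * X i.succ : MvPolynomial (Fin (m + 1)) k).IsHomogeneous 1 :=
    (isHomogeneous_X _ _).sub (isHomogeneous_C_mul_X _ _)
  rw [← homogeneousComponent_mul_left h1, hecke_spec, hecke_spec, map_add,
    homogeneousComponent_mul_left h2, homogeneousComponent_mul_left h3, rename_homogeneousComponent]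

/-- The inverse Demazure–Lusztig operator. -/
def heckeInv (i : Fin m) : Module.End k (MvPolynomial (Fin (m + 1)) k) :=
  t⁻¹ • (hecke t i - (t - 1) • 1)

theorem heckeInv_apply (i : Fin m) (p : MvPolynomial (Fin (m + 1)) k) :
    heckeInv t i p = t⁻¹ • (hecke t i p - (t - 1) • p) := rfl

variable {t}

theorem heckeInv_mul_hecke (ht : t ≠ 0) (i : Fin m) : heckeInv t i * hecke t i = 1 := by
  refine LinearMap.ext fun p => ?_
  rw [Module.End.mul_apply, heckeInv_apply, hecke_hecke, add_sub_cancel_left, smul_smul,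
    inv_mul_cancel₀ ht, one_smul, Module.End.one_apply]

theorem hecke_mul_heckeInv (ht : t ≠ 0) (i : Fin m) : hecke t i * heckeInv t i = 1 := by
  refine LinearMap.ext fun p => ?_
  rw [Module.End.mul_apply, heckeInv_apply, map_smul, map_sub, map_smul, hecke_hecke,
    add_sub_cancel_left, smul_smul, inv_mul_cancel₀ ht, one_smul, Module.End.one_apply]

variable (t)

theorem isGraded_heckeInv (i : Fin m) : IsGraded (heckeInv t i) := fun d p => by
  rw [heckeInv_apply, heckeInv_apply, map_smul, map_sub, map_smul, isGraded_hecke]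

/-- `T_0 T_1 ⋯ T_{j-1}`. -/
def heckeUp : ∀ j, j ≤ m → Module.End k (MvPolynomial (Fin (m + 1)) k)
  | 0, _ => 1
  | j + 1, h => heckeUp j (Nat.le_of_succ_le h) * hecke t ⟨j, h⟩

/-- `T_{j-1} ⋯ T_1 T_0`. -/
def heckeDown : ∀ j, j ≤ m → Module.End k (MvPolynomial (Fin (m + 1)) k)
  | 0, _ => 1
  | j + 1, h => hecke t ⟨j, h⟩ * heckeDown j (Nat.le_of_succ_le h)

/-- The inverse of `T_0 T_1 ⋯ T_{j-1}`. -/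
def heckeUpInv : ∀ j, j ≤ m → Module.End k (MvPolynomial (Fin (m + 1)) k)
  | 0, _ => 1
  | j + 1, h => heckeInv t ⟨j, h⟩ * heckeUpInv j (Nat.le_of_succ_le h)

/-- The inverse of `T_{j-1} ⋯ T_1 T_0`. -/
def heckeDownInv : ∀ j, j ≤ m → Module.End k (MvPolynomial (Fin (m + 1)) k)
  | 0, _ => 1
  | j + 1, h => heckeDownInv j (Nat.le_of_succ_le h) * heckeInv t ⟨j, h⟩

variable {t}

theorem heckeUpInv_mul_heckeUp (ht : t ≠ 0) : ∀ j (h : j ≤ m),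
    heckeUpInv t j h * heckeUp t j h = 1
  | 0, _ => one_mul 1
  | j + 1, h => by
    rw [heckeUp, heckeUpInv, mul_assoc, ← mul_assoc _ _ (hecke t _), heckeUpInv_mul_heckeUp ht j,
      one_mul, heckeInv_mul_hecke ht]

theorem heckeUp_mul_heckeUpInv (ht : t ≠ 0) : ∀ j (h : j ≤ m),
    heckeUp t j h * heckeUpInv t j h = 1
  | 0, _ => one_mul 1
  | j + 1, h => by
    rw [heckeUp, heckeUpInv, mul_assoc, ← mul_assoc (hecke t _), hecke_mul_heckeInv ht, one_mul,
      heckeUp_mul_heckeUpInv ht j]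

theorem heckeDown_mul_heckeDownInv (ht : t ≠ 0) : ∀ j (h : j ≤ m),
    heckeDown t j h * heckeDownInv t j h = 1
  | 0, _ => one_mul 1
  | j + 1, h => by
    rw [heckeDown, heckeDownInv, mul_assoc, ← mul_assoc (heckeDown t j _),
      heckeDown_mul_heckeDownInv ht j, one_mul, hecke_mul_heckeInv ht]

variable (t)

theorem heckeUp_X_mul_heckeDown (j : ℕ) (h : j ≤ m)
    (p : MvPolynomial (Fin (m + 1)) k) :
    heckeUp t j h (X ⟨j, Nat.lt_succ_of_le h⟩ * heckeDown t j h p) = t ^ j • (X 0 * p) := by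
  induction j generalizing p with
  | zero => simp [heckeUp, heckeDown]
  | succ j ih =>
    rw [heckeUp, heckeDown, Module.End.mul_apply, Module.End.mul_apply]
    have := hecke_X_mul_hecke t ⟨j, h⟩ (heckeDown t j (Nat.le_of_succ_le h) p)
    rw [Fin.succ_mk] at this
    rw [this, map_smul, Fin.castSucc_mk, ih, smul_smul, pow_succ']

theorem isGraded_heckeUp : ∀ j (h : j ≤ m), IsGraded (heckeUp t j h)
  | 0, _ => isGraded_one
  | j + 1, _ => (isGraded_heckeUp j _).mul (isGraded_hecke t _)

theorem isGraded_heckeDown : ∀ j (h : j ≤ m), IsGraded (heckeDown t j h)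
  | 0, _ => isGraded_one
  | j + 1, _ => (isGraded_hecke t _).mul (isGraded_heckeDown j _)

theorem isGraded_heckeUpInv : ∀ j (h : j ≤ m), IsGraded (heckeUpInv t j h)
  | 0, _ => isGraded_one
  | j + 1, _ => (isGraded_heckeInv t _).mul (isGraded_heckeUpInv j _)

/-- The homomorphism `x_l ↦ x_{l+1}` for `l < j`, `x_j ↦ 0`, `x_l ↦ x_l` for `l > j`. -/
def shiftZero (j : ℕ) : MvPolynomial (Fin (m + 1)) k →ₐ[k] MvPolynomial (Fin (m + 1)) k :=
  aeval fun l => if (l : ℕ) < j then X (Fin.ofNat (m + 1) (l + 1)) else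
    if (l : ℕ) = j then 0 else X l

/-- Putting `x_i = 0` in the defining relation kills the term in `p` and leaves `-x_{i+1} T_i p = -t
x_{i+1} s_i p`; the transposition then moves the zero to the next index. -/
theorem shiftZero_hecke (i : Fin m) (p : MvPolynomial (Fin (m + 1)) k) :
    shiftZero (k := k) i (hecke t i p) = t • shiftZero (i + 1) p := by
  have h0 : shiftZero (i : ℕ) (X i.castSucc : MvPolynomial (Fin (m + 1)) k) = 0 := by
    simp [shiftZero]
  have h1 : shiftZero (i : ℕ) (X i.succ : MvPolynomial (Fin (m + 1)) k) = X i.succ := by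
    simp [shiftZero]
  have h2 : (shiftZero (i : ℕ)).comp (rename (adj i)) =
      (shiftZero (i + 1) : MvPolynomial (Fin (m + 1)) k →ₐ[k] _) := by
    ext1 j
    rw [AlgHom.comp_apply, rename_X]
    by_cases hj : j = i.castSucc
    · rw [hj, adj_castSucc, h1]
      simp only [shiftZero, aeval_X, Fin.val_castSucc, Nat.lt_succ_self, if_true]
      congr 1
      ext
      simp only [Fin.val_succ, Fin.val_ofNat]
      exact (Nat.mod_eq_of_lt (by omega)).symm
    · by_cases hj' : j = i.succ
      · rw [hj', adj_succ, h0]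
        simp [shiftZero]
      · rw [adj_of_ne hj hj']
        simp only [shiftZero, aeval_X]
        have h3 : (j : ℕ) ≠ i := fun h => hj (Fin.ext h)
        have h4 : (j : ℕ) ≠ i + 1 := fun h => hj' (Fin.ext h)
        have h5 : (j : ℕ) < i + 1 ↔ (j : ℕ) < i := by omega
        simp only [h3, h4, h5]
  have h3 := congrArg (shiftZero (k := k) (m := m) i) (hecke_spec t i p)
  rw [map_mul, map_add, map_mul, map_mul, map_mul, map_sub, map_sub, map_sub, map_mul, map_one, h0,
    h1, algHom_C, ← AlgHom.comp_apply, h2] at h3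
  refine mul_left_cancel₀ (X_ne_zero i.succ : (X i.succ : MvPolynomial (Fin (m + 1)) k) ≠ 0) ?_
  rw [smul_eq_C_mul]
  rw [algebraMap_eq] at h3
  linear_combination -h3

/-- For `j = m` the factor `t ^ m` is what cancels the constant `t ^ (-m)` in the Cherednik
equations, making them divisible by `x_1`. -/
theorem shiftZero_heckeUp (j : ℕ) (h : j ≤ m) (p : MvPolynomial (Fin (m + 1)) k) :
    shiftZero (k := k) 0 (heckeUp t j h p) = t ^ j • shiftZero j p := by
  induction j generalizing p with
  | zero => simp [heckeUp]
  | succ j ih =>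
    rw [heckeUp, Module.End.mul_apply, ih, shiftZero_hecke t ⟨j, h⟩, smul_smul, pow_succ]

theorem X_zero_dvd_of_shiftZero {p : MvPolynomial (Fin (m + 1)) k}
    (hp : shiftZero (k := k) 0 p = 0) : X 0 ∣ p := by
  have h : (Ideal.Quotient.mkₐ k (Ideal.span {(X 0 : MvPolynomial (Fin (m + 1)) k)})).comp
      (shiftZero 0) = Ideal.Quotient.mkₐ k _ := by
    ext j
    simp only [AlgHom.comp_apply, shiftZero, aeval_X, Ideal.Quotient.mkₐ_eq_mk]
    rw [Ideal.Quotient.eq, Ideal.mem_span_singleton]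
    by_cases h1 : j = 0
    · simp [h1]
    · have : (j : ℕ) ≠ 0 := fun h => h1 (Fin.ext h)
      simp [this]
  have h2 := AlgHom.congr_fun h p
  rw [AlgHom.comp_apply, hp, map_zero] at h2
  exact Ideal.mem_span_singleton.1 (Ideal.Quotient.eq_zero_iff_mem.1 h2.symm)

end Hecke

/-! ### The affine rotation on polynomials -/

section Rotation

variable (q : k)

/-- The operator `p ↦ p(q⁻¹ x_n, x_1, …, x_{n-1})`. -/
def rotPoly : MvPolynomial (Fin (m + 1)) k →ₐ[k] MvPolynomial (Fin (m + 1)) k :=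
  aeval (Fin.cons (C q⁻¹ * X (Fin.last m)) fun i => X i.castSucc)

/-- The operator `p ↦ p(x_2, …, x_n, q x_1)`. -/
def rotPolyInv : MvPolynomial (Fin (m + 1)) k →ₐ[k] MvPolynomial (Fin (m + 1)) k :=
  aeval (rotate (C q * ·) X)

theorem isGraded_rotPoly : IsGraded (rotPoly (m := m) q).toLinearMap :=
  isGraded_aeval fun i => by
    induction i using Fin.cases with
    | zero => exact isHomogeneous_C_mul_X _ _
    | succ i => exact isHomogeneous_X _ _

theorem isGraded_rotPolyInv : IsGraded (rotPolyInv (m := m) q).toLinearMap :=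
  isGraded_aeval fun i => by
    induction i using Fin.lastCases with
    | last => rw [rotate_last]; exact isHomogeneous_C_mul_X _ _
    | cast i => rw [rotate_castSucc]; exact isHomogeneous_X _ _

theorem eval_rotPoly (x : Fin (m + 1) → k) (p : MvPolynomial (Fin (m + 1)) k) :
    eval x (rotPoly q p) =
      eval (Fin.cons (q⁻¹ * x (Fin.last m)) fun i => x i.castSucc : Fin (m + 1) → k) p := by
  have : (eval x).comp (rotPoly q).toRingHom =
      eval (Fin.cons (q⁻¹ * x (Fin.last m)) fun i => x i.castSucc : Fin (m + 1) → k) := by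
    ext i
    · simp [rotPoly]
    · induction i using Fin.cases <;> simp [rotPoly]
  exact congrArg (· p) this

theorem eval_rotPolyInv (x : Fin (m + 1) → k) (p : MvPolynomial (Fin (m + 1)) k) :
    eval x (rotPolyInv q p) = eval (rotate (q * ·) x) p := by
  have : (eval x).comp (rotPolyInv q).toRingHom = eval (rotate (q * ·) x) := by
    ext i
    · simp [rotPolyInv]
    · induction i using Fin.lastCases <;> simp [rotPolyInv]
  exact congrArg (· p) this

variable {q}

theorem rotPolyInv_rotPoly (hq : q ≠ 0) (p : MvPolynomial (Fin (m + 1)) k) :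
    rotPolyInv q (rotPoly q p) = p := by
  have : (rotPolyInv q).comp (rotPoly q) = AlgHom.id k (MvPolynomial (Fin (m + 1)) k) := by
    ext1 i
    induction i using Fin.cases with
    | zero =>
      simp only [rotPoly, rotPolyInv, AlgHom.comp_apply, aeval_X, Fin.cons_zero, map_mul,
        rotate_last, algHom_C, algebraMap_eq, AlgHom.id_apply]
      rw [← mul_assoc, ← C_mul, inv_mul_cancel₀ hq, C_1, one_mul]
    | succ i => simp [rotPoly, rotPolyInv]
  exact AlgHom.congr_fun this p

variable (q)

theorem shiftZero_zero_rotPolyInv (p : MvPolynomial (Fin (m + 1)) k) :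
    shiftZero (k := k) 0 (rotPolyInv q p) = shiftZero m p := by
  have : (shiftZero 0).comp (rotPolyInv q) =
      (shiftZero m : MvPolynomial (Fin (m + 1)) k →ₐ[k] _) := by
    ext1 i
    induction i using Fin.lastCases with
    | last => simp [rotPolyInv, shiftZero]
    | cast i =>
      simp only [rotPolyInv, shiftZero, AlgHom.comp_apply, aeval_X, rotate_castSucc]
      simp only [Fin.val_castSucc, i.2, if_true, Fin.val_succ]
      simp only [Nat.succ_ne_zero, not_lt_zero, if_false]
      congr 1
      ext
      simp only [Fin.val_succ, Fin.val_ofNat]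
      exact (Nat.mod_eq_of_lt (by omega)).symm
  exact AlgHom.congr_fun this p

theorem shiftZero_rotPoly (p : MvPolynomial (Fin (m + 1)) k) :
    shiftZero (k := k) m (rotPoly q p) = shiftZero 0 p := by
  have : (shiftZero m).comp (rotPoly q) =
      (shiftZero 0 : MvPolynomial (Fin (m + 1)) k →ₐ[k] _) := by
    ext1 i
    induction i using Fin.cases with
    | zero => simp [rotPoly, shiftZero]
    | succ i =>
      simp only [rotPoly, shiftZero, AlgHom.comp_apply, aeval_X, Fin.cons_succ]
      simp only [Fin.val_castSucc, i.2, if_true, Fin.val_succ]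
      simp only [Nat.succ_ne_zero, not_lt_zero, if_false]
      congr 1
      ext
      simp only [Fin.val_succ, Fin.val_ofNat]
      exact Nat.mod_eq_of_lt (by omega)
  exact AlgHom.congr_fun this p

end Rotation

end

section

variable {k : Type*} [Field k] {q t : k} {m : ℕ}

/-! ### Values of the operators at multiples of spectral vectors -/

section Evaluation

/-- The diagonal coefficient of a Demazure–Lusztig operator at a spectral vector. -/
def diagCoeff (q t : k) (v : Fin (m + 1) → ℤ) (i : Fin m) : k :=
  (t - 1) * bar q t v i.castSucc / (bar q t v i.castSucc - bar q t v i.succ)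

theorem IsGeneric.diagCoeff_of_eq (h : IsGeneric q t) {v : Fin (m + 1) → ℤ} {i : Fin m}
    (hv : v i.castSucc = v i.succ) : diagCoeff q t v i = t := by
  have h1 := sub_ne_zero.2 (h.bar_castSucc_ne v i)
  rw [diagCoeff, div_eq_iff h1, h.bar_castSucc_of_eq hv]
  ring

theorem IsGeneric.diagCoeff_ne (h : IsGeneric q t) {v : Fin (m + 1) → ℤ} {i : Fin m}
    (hv : v i.castSucc ≠ v i.succ) : t - diagCoeff q t v i ≠ 0 := by
  have h1 := sub_ne_zero.2 (h.bar_castSucc_ne v i)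
  have h2 := h.bar_castSucc_ne_mul hv
  rw [diagCoeff, sub_ne_zero, ne_eq, eq_div_iff h1]
  contrapose! h2
  linear_combination h2

theorem eval_rename_adj (x : Fin (m + 1) → k) (i : Fin m) (p : MvPolynomial (Fin (m + 1)) k) :
    eval x (rename (adj i) p) = eval (x ∘ adj i) p := eval_rename _ _ _

/-- Off ties, swapping entries of `v` swaps coordinates of its spectral vector. On a tie the factor
`x_i - t x_{i+1}` vanishes, so the swapped value does not enter. All conditions are homogeneous, so
the multiple `c` is free. -/
theorem IsGeneric.eval_hecke (h : IsGeneric q t) {c : k} (hc : c ≠ 0) (v : Fin (m + 1) → ℤ)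
    (i : Fin m) (p : MvPolynomial (Fin (m + 1)) k) :
    eval (c • bar q t v) (hecke t i p) = diagCoeff q t v i * eval (c • bar q t v) p +
      (t - diagCoeff q t v i) * eval (c • bar q t (v ∘ adj i)) p := by
  have h1 := sub_ne_zero.2 (h.bar_castSucc_ne v i)
  have h2 := congrArg (eval (c • bar q t v)) (hecke_spec t i p)
  simp only [map_mul, map_sub, map_add, map_one, eval_X, eval_C, eval_rename_adj, Pi.smul_apply,
    smul_eq_mul] at h2
  refine mul_left_cancel₀ (mul_ne_zero hc h1) ?_
  rw [mul_sub, h2]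
  by_cases hv : v i.castSucc = v i.succ
  · rw [h.diagCoeff_of_eq hv, h.bar_castSucc_of_eq hv]
    ring
  · rw [bar_comp_adj hv, diagCoeff]
    have h3 : (c • bar q t v) ∘ adj i = c • (bar q t v ∘ adj i) := rfl
    rw [h3]
    field_simp
    ring

/-- All entries of `0` are tied, so evaluation at a multiple of `τ` is a one-dimensional character
of the Hecke algebra. -/
theorem IsGeneric.eval_hecke_tau (h : IsGeneric q t) {c : k} (hc : c ≠ 0) (i : Fin m)
    (p : MvPolynomial (Fin (m + 1)) k) :
    eval (c • bar q t 0) (hecke t i p) = t * eval (c • bar q t 0) p ∧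
      eval (c • bar q t 0) (heckeInv t i p) = t⁻¹ * eval (c • bar q t 0) p := by
  have h1 : eval (c • bar q t 0) (hecke t i p) = t * eval (c • bar q t 0) p := by
    rw [h.eval_hecke hc, h.diagCoeff_of_eq rfl, sub_self, zero_mul, add_zero]
  refine ⟨h1, ?_⟩
  rw [heckeInv_apply, smul_eval, map_sub, smul_eval, h1]
  ring

theorem IsGeneric.eval_heckeUp_tau (h : IsGeneric q t) {c : k} (hc : c ≠ 0) (j : ℕ) (hj : j ≤ m)
    (p : MvPolynomial (Fin (m + 1)) k) :
    eval (c • bar q t 0) (heckeUp t j hj p) = t ^ j * eval (c • bar q t 0) p := by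
  induction j generalizing p with
  | zero => simp [heckeUp]
  | succ j ih =>
    rw [heckeUp, Module.End.mul_apply, ih, (h.eval_hecke_tau hc _ _).1]
    ring

theorem IsGeneric.eval_heckeDown_tau (h : IsGeneric q t) {c : k} (hc : c ≠ 0) (j : ℕ) (hj : j ≤ m)
    (p : MvPolynomial (Fin (m + 1)) k) :
    eval (c • bar q t 0) (heckeDown t j hj p) = t ^ j * eval (c • bar q t 0) p := by
  induction j generalizing p with
  | zero => simp [heckeDown]
  | succ j ih =>
    rw [heckeDown, Module.End.mul_apply, (h.eval_hecke_tau hc _ _).1, ih]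
    ring

theorem IsGeneric.eval_heckeUpInv_tau (h : IsGeneric q t) {c : k} (hc : c ≠ 0) (j : ℕ) (hj : j ≤ m)
    (p : MvPolynomial (Fin (m + 1)) k) :
    eval (c • bar q t 0) (heckeUpInv t j hj p) = (t ^ j)⁻¹ * eval (c • bar q t 0) p := by
  induction j generalizing p with
  | zero => simp [heckeUpInv]
  | succ j ih =>
    rw [heckeUpInv, Module.End.mul_apply, (h.eval_hecke_tau hc _ _).2, ih]
    rw [pow_succ, mul_inv]
    ring

/-- The raising operator `p ↦ (x_n - t^{1-n}) p(q⁻¹ x_n, x_1, …, x_{n-1})`. -/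
def raise (q t : k) (p : MvPolynomial (Fin (m + 1)) k) : MvPolynomial (Fin (m + 1)) k :=
  (X (Fin.last m) - C (t ^ m)⁻¹) * rotPoly q p

variable (m) in
/-- The raising operator `p ↦ (x_1 - 1) p(x_2, …, x_n, q x_1)`. -/
def raiseInv (q : k) : Module.End k (MvPolynomial (Fin (m + 1)) k) :=
  LinearMap.mulLeft k (X 0 - 1) ∘ₗ (rotPolyInv q).toLinearMap

theorem raiseInv_apply (p : MvPolynomial (Fin (m + 1)) k) :
    raiseInv m q p = (X 0 - 1) * rotPolyInv q p := rfl

theorem IsGeneric.eval_raiseInv (h : IsGeneric q t) (c : k) (v : Fin (m + 1) → ℤ)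
    (p : MvPolynomial (Fin (m + 1)) k) :
    eval (c • bar q t v) (raiseInv m q p) =
      (c * bar q t v 0 - 1) * eval (c • bar q t (rotate (· + 1) v)) p := by
  have : rotate (q * ·) (c • bar q t v) = c • bar q t (rotate (· + 1) v) := by
    rw [h.bar_rotate]
    funext i
    induction i using Fin.lastCases with
    | last => simp; ring
    | cast i => simp
  rw [raiseInv_apply, map_mul, eval_rotPolyInv, this]
  simp

theorem IsGeneric.eval_raise_rotate (h : IsGeneric q t) (v : Fin (m + 1) → ℤ)
    (p : MvPolynomial (Fin (m + 1)) k) :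
    eval (bar q t (rotate (· + 1) v)) (raise q t p) =
      (bar q t (rotate (· + 1) v) (Fin.last m) - (t ^ m)⁻¹) * eval (bar q t v) p := by
  have : (Fin.cons (q⁻¹ * bar q t (rotate (· + 1) v) (Fin.last m))
      fun i => bar q t (rotate (· + 1) v) i.castSucc : Fin (m + 1) → k) = bar q t v := by
    rw [h.bar_rotate]
    funext i
    induction i using Fin.cases with
    | zero => simp [h.q_ne_zero]
    | succ i => simp
  rw [raise, map_mul, eval_rotPoly, this]
  simp

end Evaluation

/-! ### Preservation of the vanishing conditions -/

section Vanishing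

variable {n : ℕ}

/-- Vanishing at the spectral vectors of the `v ≤ 0` with `-∑ v_i < d`. -/
def VanishesNeg (q t : k) (d : ℕ) (p : MvPolynomial (Fin n) k) : Prop :=
  ∀ v : Fin n → ℤ, (∀ i, v i ≤ 0) → -∑ i, v i < d → eval (bar q t v) p = 0

theorem vanishesNeg_iff {d : ℕ} {p : MvPolynomial (Fin n) k} :
    VanishesNeg q t d p ↔ ∀ β : Fin n → ℕ, size β < d → eval (tildeC q t β) p = 0 := by
  have hrev (β : Fin n → ℤ) : ∑ i, β (Fin.rev i) = ∑ i, β i := Equiv.sum_comp Fin.revPerm β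
  constructor
  · intro h β hβ
    refine h _ (fun i => by simp) ?_
    rw [Finset.sum_neg_distrib, neg_neg, hrev fun i => (β i : ℤ)]
    rw [size] at hβ
    exact_mod_cast hβ
  · intro h v hv hd
    have h1 (i : Fin n) : ((-v (Fin.rev i)).toNat : ℤ) = -v (Fin.rev i) := by
      have := hv (Fin.rev i)
      omega
    have := h (fun i => (-v (Fin.rev i)).toNat) (by
      zify
      rw [size]
      push_cast
      rw [← Finset.sum_neg_distrib, ← hrev] at hd
      convert hd using 2 with i
      have := h1 i
      omega)
    have h2 (i : Fin n) : -((-v i).toNat : ℤ) = v i := by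
      have := hv i
      omega
    simpa only [tildeC, Fin.rev_rev, h2] using this

theorem VanishesNeg.mono {d e : ℕ} (hde : d ≤ e) {p : MvPolynomial (Fin n) k}
    (hp : VanishesNeg q t e p) : VanishesNeg q t d p := fun v hv hd => hp v hv (by omega)

theorem VanishesNeg.add {d : ℕ} {p r : MvPolynomial (Fin n) k} (hp : VanishesNeg q t d p)
    (hr : VanishesNeg q t d r) : VanishesNeg q t d (p + r) := fun v hv hd => by
  rw [map_add, hp v hv hd, hr v hv hd, add_zero]

theorem VanishesNeg.smul {d : ℕ} {p : MvPolynomial (Fin n) k} (hp : VanishesNeg q t d p)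
    (c : k) : VanishesNeg q t d (c • p) := fun v hv hd => by
  rw [smul_eval, hp v hv hd, mul_zero]

theorem VanishesNeg.sub {d : ℕ} {p r : MvPolynomial (Fin n) k} (hp : VanishesNeg q t d p)
    (hr : VanishesNeg q t d r) : VanishesNeg q t d (p - r) := fun v hv hd => by
  rw [map_sub, hp v hv hd, hr v hv hd, sub_zero]

theorem VanishesNeg.hecke (h : IsGeneric q t) {d : ℕ} {p : MvPolynomial (Fin (m + 1)) k}
    (hp : VanishesNeg q t d p) (i : Fin m) : VanishesNeg q t d (hecke t i p) := fun v hv hd => by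
  have := h.eval_hecke one_ne_zero v i p
  rw [one_smul, one_smul, hp v hv hd, hp (v ∘ adj i) (fun i => hv _)
    (by rwa [show ∑ j, (v ∘ adj i) j = ∑ j, v j from Equiv.sum_comp (adj i) v])] at this
  simpa using this

theorem VanishesNeg.heckeInv (h : IsGeneric q t) {d : ℕ} {p : MvPolynomial (Fin (m + 1)) k}
    (hp : VanishesNeg q t d p) (i : Fin m) : VanishesNeg q t d (heckeInv t i p) :=
  ((hp.hecke h i).sub (hp.smul _)).smul _

theorem VanishesNeg.heckeUp (h : IsGeneric q t) {d : ℕ} (j : ℕ) (hj : j ≤ m)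
    {p : MvPolynomial (Fin (m + 1)) k} (hp : VanishesNeg q t d p) :
    VanishesNeg q t d (heckeUp t j hj p) := by
  induction j generalizing p with
  | zero => exact hp
  | succ j ih =>
    rw [InterpolationMacdonald.heckeUp, Module.End.mul_apply]
    exact ih _ (hp.hecke h _)

theorem VanishesNeg.heckeDown (h : IsGeneric q t) {d : ℕ} (j : ℕ) (hj : j ≤ m)
    {p : MvPolynomial (Fin (m + 1)) k} (hp : VanishesNeg q t d p) :
    VanishesNeg q t d (heckeDown t j hj p) := by
  induction j generalizing p with
  | zero => exact hp
  | succ j ih =>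
    rw [InterpolationMacdonald.heckeDown, Module.End.mul_apply]
    exact (ih _ hp).hecke h _

theorem VanishesNeg.heckeUpInv (h : IsGeneric q t) {d : ℕ} (j : ℕ) (hj : j ≤ m)
    {p : MvPolynomial (Fin (m + 1)) k} (hp : VanishesNeg q t d p) :
    VanishesNeg q t d (heckeUpInv t j hj p) := by
  induction j generalizing p with
  | zero => exact hp
  | succ j ih =>
    rw [InterpolationMacdonald.heckeUpInv, Module.End.mul_apply]
    exact (ih _ hp).heckeInv h _

theorem sum_rotate (v : Fin (m + 1) → ℤ) : ∑ i, rotate (· + 1) v i = ∑ i, v i + 1 := by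
  rw [Fin.sum_univ_castSucc, Fin.sum_univ_succ]
  simp
  ring

/-- If `v 0 < 0`, rotation keeps `v` nonpositive and lowers its size by one. If `v 0 = 0`, it is a
maximal first entry, so the first coordinate is `1` and the factor `x_1 - 1` vanishes. -/
theorem VanishesNeg.raiseInv (h : IsGeneric q t) {d : ℕ} {p : MvPolynomial (Fin (m + 1)) k}
    (hp : VanishesNeg q t d p) : VanishesNeg q t (d + 1) (raiseInv m q p) := fun v hv hd => by
  have h1 := h.eval_raiseInv 1 v p
  rw [one_smul, one_smul, one_mul] at h1
  rw [h1]
  rcases (hv 0).lt_or_eq with h0 | h0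
  · rw [hp _ ?_ ?_, mul_zero]
    · intro i
      induction i using Fin.lastCases with
      | last => rw [rotate_last]; omega
      | cast i => rw [rotate_castSucc]; exact hv _
    · rw [sum_rotate]
      push_cast at hd
      omega
  · have : kStat v 0 = 0 := by
      simp [kStat, h0, hv, Finset.filter_eq_empty_iff]
    simp [bar, this, h0]

/-- Vanishing at the spectral vectors of the compositions of size at most `d`. -/
def VanishesPos (q t : k) (d : ℕ) (p : MvPolynomial (Fin n) k) : Prop :=
  ∀ β : Fin n → ℕ, size β ≤ d → eval (barC q t β) p = 0

theorem size_comp_adj (β : Fin (m + 1) → ℕ) (i : Fin m) : size (β ∘ adj i) = size β :=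
  Equiv.sum_comp (adj i) β

theorem comp_adj_eq_self {α : Fin (m + 1) → ℕ} {i : Fin m} (hα : α i.castSucc = α i.succ) :
    α ∘ adj i = α := by
  funext j
  by_cases h1 : j = i.castSucc
  · rw [h1, Function.comp_apply, adj_castSucc, hα]
  · by_cases h2 : j = i.succ
    · rw [h2, Function.comp_apply, adj_succ, hα]
    · rw [Function.comp_apply, adj_of_ne h1 h2]

theorem IsGeneric.eval_hecke_barC (h : IsGeneric q t) (β : Fin (m + 1) → ℕ)
    (i : Fin m) (p : MvPolynomial (Fin (m + 1)) k) :
    eval (barC q t β) (hecke t i p) =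
      diagCoeff q t (fun j => (β j : ℤ)) i * eval (barC q t β) p +
      (t - diagCoeff q t (fun j => (β j : ℤ)) i) * eval (barC q t (β ∘ adj i)) p := by
  have := h.eval_hecke one_ne_zero (fun j => (β j : ℤ)) i p
  rw [one_smul, one_smul] at this
  exact this

theorem VanishesPos.hecke (h : IsGeneric q t) {d : ℕ} {p : MvPolynomial (Fin (m + 1)) k}
    (hp : VanishesPos q t d p) (i : Fin m) : VanishesPos q t d (hecke t i p) := fun β hβ => by
  rw [h.eval_hecke_barC, hp β hβ, hp (β ∘ adj i) (by rwa [size_comp_adj]), mul_zero, mul_zero,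
    add_zero]

theorem VanishesPos.heckeUp (h : IsGeneric q t) {d : ℕ} (j : ℕ) (hj : j ≤ m)
    {p : MvPolynomial (Fin (m + 1)) k} (hp : VanishesPos q t d p) :
    VanishesPos q t d (heckeUp t j hj p) := by
  induction j generalizing p with
  | zero => exact hp
  | succ j ih =>
    rw [InterpolationMacdonald.heckeUp, Module.End.mul_apply]
    exact ih _ (hp.hecke h _)

/-- The composition `(α_2, …, α_n, α_1 + 1)`. -/
def rotC (α : Fin (m + 1) → ℕ) : Fin (m + 1) → ℕ := rotate (· + 1) α

theorem cast_rotC (α : Fin (m + 1) → ℕ) :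
    (fun i => (rotC α i : ℤ)) = rotate (· + 1) fun i => (α i : ℤ) := by
  funext i
  induction i using Fin.lastCases <;> simp [rotC]

theorem size_rotC (α : Fin (m + 1) → ℕ) : size (rotC α) = size α + 1 := by
  rw [size, size, Fin.sum_univ_castSucc, Fin.sum_univ_succ]
  simp [rotC]
  ring

theorem exists_rotC {β : Fin (m + 1) → ℕ} (hβ : β (Fin.last m) ≠ 0) : ∃ α, β = rotC α := by
  refine ⟨Fin.cons (β (Fin.last m) - 1) fun i => β i.castSucc, ?_⟩
  funext i
  induction i using Fin.lastCases with
  | last =>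
    simp [rotC]
    omega
  | cast i => simp [rotC]

theorem kStat_last_of_eq_zero {β : Fin (m + 1) → ℕ} (hβ : β (Fin.last m) = 0) :
    kStat (fun i => (β i : ℤ)) (Fin.last m) = m := by
  rw [kStat_eq_sum, Fin.sum_univ_castSucc]
  simp [hβ, Fin.castSucc_lt_last]

/-- A final zero entry has all others at least as large before it, so its coordinate is `t ^ (-m)`,
the root of the linear factor. All other compositions are rotations. -/
theorem eval_raise_of_last {β : Fin (m + 1) → ℕ} (hβ : β (Fin.last m) = 0)
    (p : MvPolynomial (Fin (m + 1)) k) : eval (barC q t β) (raise q t p) = 0 := by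
  rw [raise, map_mul]
  simp [barC, bar, kStat_last_of_eq_zero hβ, hβ]

theorem IsGeneric.eval_raise_rotC (h : IsGeneric q t) (β : Fin (m + 1) → ℕ)
    (p : MvPolynomial (Fin (m + 1)) k) : eval (barC q t (rotC β)) (raise q t p) =
      (barC q t (rotC β) (Fin.last m) - (t ^ m)⁻¹) * eval (barC q t β) p := by
  have := h.eval_raise_rotate (fun i => (β i : ℤ)) p
  rw [← cast_rotC] at this
  exact this

end Vanishing

end

section

variable {k : Type*} [Field k] {q t : k}

/-! ### Recognition of multiples of the interpolation polynomials -/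

section Characterization

variable {n : ℕ}

theorem totalDegree_sub_le_of_le {p r : MvPolynomial (Fin n) k} {d : ℕ} (hp : p.totalDegree ≤ d)
    (hr : r.totalDegree ≤ d) : (p - r).totalDegree ≤ d :=
  (totalDegree_sub _ _).trans (max_le hp hr)

theorem totalDegree_add_le_of_le {p r : MvPolynomial (Fin n) k} {d : ℕ} (hp : p.totalDegree ≤ d)
    (hr : r.totalDegree ≤ d) : (p + r).totalDegree ≤ d :=
  (totalDegree_add _ _).trans (max_le hp hr)

theorem totalDegree_smul_le_of_le {p : MvPolynomial (Fin n) k} {d : ℕ} (hp : p.totalDegree ≤ d)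
    (c : k) : (c • p).totalDegree ≤ d :=
  (totalDegree_smul_le _ _).trans hp

theorem IsGeneric.totalDegree_G_le (h : IsGeneric q t) (α : Fin n → ℕ) :
    (G q t α).totalDegree ≤ size α := (h.isInterpolation_G α).1

theorem IsGeneric.totalDegree_GPrime_le (h : IsGeneric q t) (α : Fin n → ℕ) :
    (GPrime q t α).totalDegree ≤ size α := (h.isPrimedInterpolation_GPrime α).1

theorem IsGeneric.eval_G_of_ne (h : IsGeneric q t) {α β : Fin n → ℕ} (hβ : size β ≤ size α)
    (hne : β ≠ α) : eval (barC q t β) (G q t α) = 0 := (h.isInterpolation_G α).2.1 β hβ hne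

theorem IsGeneric.top_GPrime (h : IsGeneric q t) (α : Fin n → ℕ) :
    homogeneousComponent (size α) (GPrime q t α) = homogeneousComponent (size α) (G q t α) :=
  (h.isPrimedInterpolation_GPrime α).2.1

theorem IsGeneric.vanishesNeg_GPrime (h : IsGeneric q t) (α : Fin n → ℕ) :
    VanishesNeg q t (size α) (GPrime q t α) :=
  vanishesNeg_iff.2 (h.isPrimedInterpolation_GPrime α).2.2

theorem IsGeneric.eq_zero_of_vanishesPos (h : IsGeneric q t) {d : ℕ} {p : MvPolynomial (Fin n) k}
    (hp : p.totalDegree ≤ d) (hv : VanishesPos q t d p) : p = 0 :=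
  h.eq_zero_of_barC (B := ∅) (by simp) hp (by simp) fun β hβ _ => hv β hβ

theorem IsGeneric.eq_zero_of_vanishesNeg (h : IsGeneric q t) {d : ℕ} {p : MvPolynomial (Fin n) k}
    (hp : p.totalDegree ≤ d) (htop : homogeneousComponent d p = 0) (hv : VanishesNeg q t d p) :
    p = 0 :=
  h.eq_zero_of_tildeC hp htop (vanishesNeg_iff.1 hv)

/-- Images under operators are identified by degree and zeros alone, whatever the resulting
constant. -/
theorem IsGeneric.eq_smul_G (h : IsGeneric q t) {α : Fin n → ℕ} {p : MvPolynomial (Fin n) k}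
    (hp : p.totalDegree ≤ size α)
    (hv : ∀ β : Fin n → ℕ, size β ≤ size α → β ≠ α → eval (barC q t β) p = 0) :
    p = coeff (expo α) p • G q t α := by
  obtain ⟨h1, h2, h3⟩ := h.isInterpolation_G α
  rw [← sub_eq_zero]
  refine h.eq_zero_of_barC (d := size α) (B := {α}) (by simp)
    (totalDegree_sub_le_of_le hp (totalDegree_smul_le_of_le h1 _)) ?_ fun β hβ hβα => ?_
  · rintro _ rfl
    rw [coeff_sub, coeff_smul, h3, smul_eq_mul, mul_one, sub_self]
  · rw [map_sub, smul_eval, hv β hβ (by simpa using hβα), h2 β hβ (by simpa using hβα), mul_zero,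
      sub_self]

theorem IsGeneric.eq_smul_GPrime (h : IsGeneric q t) {α : Fin n → ℕ} {p : MvPolynomial (Fin n) k}
    {c : k} (hp : p.totalDegree ≤ size α)
    (htop : homogeneousComponent (size α) p = c • homogeneousComponent (size α) (G q t α))
    (hv : VanishesNeg q t (size α) p) : p = c • GPrime q t α := by
  rw [← sub_eq_zero]
  refine h.eq_zero_of_vanishesNeg
    (totalDegree_sub_le_of_le hp (totalDegree_smul_le_of_le (h.totalDegree_GPrime_le α) c)) ?_
    (hv.sub ((h.vanishesNeg_GPrime α).smul c))
  rw [map_sub, map_smul, htop, h.top_GPrime, sub_self]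

theorem IsGeneric.G_ne_zero (h : IsGeneric q t) (α : Fin n → ℕ) : G q t α ≠ 0 := fun h0 =>
  h.eval_G_ne_zero α (by rw [h0, map_zero])

end Characterization

/-! ### Recursions and Cherednik eigenvalue equations -/

section Recursion

variable {m : ℕ}

/-- The Demazure–Lusztig operators act in the same way on `G_α` and on `G'_α`. -/
theorem IsGeneric.exists_hecke_G (h : IsGeneric q t) (α : Fin (m + 1) → ℕ) (i : Fin m) :
    ∃ b : k, hecke t i (G q t α) =
        diagCoeff q t (fun j => (α j : ℤ)) i • G q t α + b • G q t (α ∘ adj i) ∧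
      hecke t i (GPrime q t α) =
        diagCoeff q t (fun j => (α j : ℤ)) i • GPrime q t α + b • GPrime q t (α ∘ adj i) := by
  set A := diagCoeff q t (fun j => (α j : ℤ)) i with hA
  have hsize := size_comp_adj α i
  -- Subtracting the diagonal term removes the value at `ᾱ`; the only possible nonzero value left is
  -- at the swapped composition.
  have h1 := h.eq_smul_G (α := α ∘ adj i) (p := hecke t i (G q t α) - A • G q t α) (by
      rw [hsize]
      exact totalDegree_sub_le_of_le ((isGraded_hecke t i).totalDegree_le (h.totalDegree_G_le α))
        (totalDegree_smul_le_of_le (h.totalDegree_G_le α) _)) fun β hβ hne => by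
    rw [hsize] at hβ
    have hne' : β ∘ adj i ≠ α := by
      rintro rfl
      exact hne (funext fun j => by simp [adj_adj])
    rw [map_sub, smul_eval, h.eval_hecke_barC, h.eval_G_of_ne (by rwa [size_comp_adj]) hne',
      mul_zero, add_zero]
    by_cases hβα : β = α
    · rw [hβα, sub_self]
    · rw [h.eval_G_of_ne hβ hβα, mul_zero, mul_zero, sub_self]
  set b := coeff (expo (α ∘ adj i)) (hecke t i (G q t α) - A • G q t α)
  rw [sub_eq_iff_eq_add'] at h1
  refine ⟨b, h1, ?_⟩
  rw [← sub_eq_iff_eq_add']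
  refine h.eq_smul_GPrime ?_ ?_ ?_
  · rw [hsize]
    exact totalDegree_sub_le_of_le ((isGraded_hecke t i).totalDegree_le (h.totalDegree_GPrime_le α))
      (totalDegree_smul_le_of_le (h.totalDegree_GPrime_le α) _)
  -- The operators preserve degree and the top components agree, so the constant `b` is the same for
  -- both families.
  · rw [hsize, map_sub, map_smul, isGraded_hecke, h.top_GPrime, ← isGraded_hecke, h1, map_add,
      map_smul, map_smul, add_sub_cancel_left]
  · rw [hsize]
    exact ((h.vanishesNeg_GPrime α).hecke h i).sub ((h.vanishesNeg_GPrime α).smul _)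

theorem totalDegree_raise_le (p : MvPolynomial (Fin (m + 1)) k) {d : ℕ}
    (hp : p.totalDegree ≤ d) : (raise q t p).totalDegree ≤ d + 1 := by
  refine (totalDegree_mul _ _).trans ?_
  rw [add_comm d]
  refine add_le_add ((totalDegree_sub_C_le _ _).trans (totalDegree_X _).le) ?_
  exact (isGraded_rotPoly q).totalDegree_le hp

theorem totalDegree_raiseInv_le (p : MvPolynomial (Fin (m + 1)) k) {d : ℕ}
    (hp : p.totalDegree ≤ d) : (raiseInv m q p).totalDegree ≤ d + 1 := by
  refine (totalDegree_mul _ _).trans ?_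
  rw [add_comm d, ← C_1]
  refine add_le_add ((totalDegree_sub_C_le _ _).trans (totalDegree_X _).le) ?_
  exact (isGraded_rotPolyInv q).totalDegree_le hp

theorem rotPoly_homogeneousComponent (d : ℕ) (p : MvPolynomial (Fin (m + 1)) k) :
    homogeneousComponent d (rotPoly q p) = rotPoly q (homogeneousComponent d p) :=
  isGraded_rotPoly q d p

theorem rotPolyInv_homogeneousComponent (d : ℕ) (p : MvPolynomial (Fin (m + 1)) k) :
    homogeneousComponent d (rotPolyInv q p) = rotPolyInv q (homogeneousComponent d p) :=
  isGraded_rotPolyInv q d p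

theorem homogeneousComponent_X_mul (i : Fin (m + 1)) (p : MvPolynomial (Fin (m + 1)) k) (d : ℕ) :
    homogeneousComponent (d + 1) (X i * p) = X i * homogeneousComponent d p := by
  rw [add_comm d 1, homogeneousComponent_mul_left (isHomogeneous_X _ _)]

theorem totalDegree_of_X_mul {i : Fin (m + 1)} {p : MvPolynomial (Fin (m + 1)) k} {d : ℕ}
    (hp : (X i * p).totalDegree ≤ d + 1) : p.totalDegree ≤ d :=
  totalDegree_le_iff.2 fun e he => by
    have := totalDegree_le_iff.1 hp (e + 1) (by omega)
    rw [homogeneousComponent_X_mul] at this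
    exact (mul_eq_zero.1 this).resolve_left (X_ne_zero i)

theorem top_raise {p : MvPolynomial (Fin (m + 1)) k} {d : ℕ} (hp : p.totalDegree ≤ d) :
    homogeneousComponent (d + 1) (raise q t p) =
      X (Fin.last m) * rotPoly q (homogeneousComponent d p) := by
  rw [raise, sub_mul, map_sub, homogeneousComponent_X_mul, homogeneousComponent_C_mul,
    rotPoly_homogeneousComponent, rotPoly_homogeneousComponent,
    totalDegree_le_iff.1 hp (d + 1) (Nat.lt_succ_self d), map_zero, mul_zero, sub_zero]

theorem top_raiseInv {p : MvPolynomial (Fin (m + 1)) k} {d : ℕ} (hp : p.totalDegree ≤ d) :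
    homogeneousComponent (d + 1) (raiseInv m q p) =
      X 0 * rotPolyInv q (homogeneousComponent d p) := by
  rw [raiseInv_apply, sub_mul, map_sub, homogeneousComponent_X_mul, one_mul,
    rotPolyInv_homogeneousComponent, rotPolyInv_homogeneousComponent,
    totalDegree_le_iff.1 hp (d + 1) (Nat.lt_succ_self d), map_zero, sub_zero]

/-- A composition with last entry `0` is a zero by the linear factor; any other is some `rotC γ`,
where the value reduces to one of `G_α` at `γ̄`. -/
theorem IsGeneric.exists_raise_G (h : IsGeneric q t) (α : Fin (m + 1) → ℕ) :
    ∃ c : k, c ≠ 0 ∧ raise q t (G q t α) = c • G q t (rotC α) := by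
  have h1 := h.eq_smul_G (α := rotC α) (p := raise q t (G q t α))
    (by rw [size_rotC]; exact totalDegree_raise_le _ (h.totalDegree_G_le α))
    fun β hβ hne => by
      by_cases hl : β (Fin.last m) = 0
      · exact eval_raise_of_last hl _
      · obtain ⟨γ, rfl⟩ := exists_rotC hl
        rw [size_rotC, size_rotC] at hβ
        rw [h.eval_raise_rotC, h.eval_G_of_ne (by omega) (by rintro rfl; exact hne rfl), mul_zero]
  refine ⟨_, fun h0 => ?_, h1⟩
  rw [h0, zero_smul, raise] at h1
  rcases mul_eq_zero.1 h1 with h2 | h2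
  -- At the point with all coordinates `t ^ (-m) + 1` the linear factor takes the value `1`.
  · have h3 := congrArg (eval (fun _ => (t ^ m)⁻¹ + 1)) h2
    simp at h3
  · have h3 : rotPolyInv q (rotPoly q (G q t α)) = 0 := by rw [h2, map_zero]
    rw [rotPolyInv_rotPoly h.q_ne_zero] at h3
    exact h.G_ne_zero α h3

theorem IsGeneric.vanishesPos_raise_G (h : IsGeneric q t) (α : Fin (m + 1) → ℕ) :
    VanishesPos q t (size α) (raise q t (G q t α)) := fun β hβ => by
  obtain ⟨c, -, hc⟩ := h.exists_raise_G α
  rw [hc, smul_eval, h.eval_G_of_ne (by rw [size_rotC]; omega), mul_zero]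
  rintro rfl
  rw [size_rotC] at hβ
  omega

theorem IsGeneric.barC_ne_zero {n : ℕ} (h : IsGeneric q t) (α : Fin n → ℕ) (i : Fin n) :
    barC q t α i ≠ 0 := h.bar_ne_zero _ i

/-- `G_α` is an eigenfunction of the first inhomogeneous Cherednik operator. -/
theorem IsGeneric.cherednik_G (h : IsGeneric q t) (α : Fin (m + 1) → ℕ) :
    G q t α + heckeUp t m le_rfl (raise q t (G q t α)) = (barC q t α 0)⁻¹ • (X 0 * G q t α) := by
  have hdeg := h.totalDegree_G_le α
  obtain ⟨r, hr⟩ : X 0 ∣ G q t α + heckeUp t m le_rfl (raise q t (G q t α)) := by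
    refine X_zero_dvd_of_shiftZero ?_
    have h0 : shiftZero (k := k) m (X (Fin.last m)) = 0 := by simp [shiftZero]
    have ht := pow_ne_zero m h.t_ne_zero
    rw [map_add, shiftZero_heckeUp, raise, map_mul, map_sub, h0, algHom_C, shiftZero_rotPoly,
      algebraMap_eq, smul_eq_C_mul, zero_sub, neg_mul, mul_neg, ← mul_assoc, ← C_mul,
      mul_inv_cancel₀ ht, C_1, one_mul, add_neg_cancel]
  rw [hr, ← mul_smul_comm]
  congr 1
  have hrdeg : r.totalDegree ≤ size α := by
    refine totalDegree_of_X_mul (i := 0)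
      (hr ▸ totalDegree_add_le_of_le (hdeg.trans (Nat.le_succ _)) ?_)
    exact (isGraded_heckeUp t m le_rfl).totalDegree_le (totalDegree_raise_le _ hdeg)
  rw [← sub_eq_zero]
  refine h.eq_zero_of_vanishesPos
    (totalDegree_sub_le_of_le hrdeg (totalDegree_smul_le_of_le hdeg _))
    fun β hβ => ?_
  have h1 := congrArg (eval (barC q t β)) hr
  -- The raised term vanishes at all `β̄` of size at most `|α|`, so there the quotient `r` has value
  -- `G_α(β̄) / β̄_1`, which is nonzero only for `β = α`.
  rw [map_add, ((h.vanishesPos_raise_G α).heckeUp h m le_rfl) β hβ, add_zero, map_mul, eval_X] at h1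
  have h2 := h.barC_ne_zero β 0
  rw [map_sub, smul_eval]
  by_cases hβα : β = α
  · subst hβα
    rw [h1]
    field_simp
    simp
  · rw [h.eval_G_of_ne hβ hβα] at h1 ⊢
    rw [(mul_eq_zero.1 h1.symm).resolve_left h2]
    simp

/-- The top homogeneous component of `G_α`. -/
theorem IsGeneric.cherednik_top (h : IsGeneric q t) (α : Fin (m + 1) → ℕ) :
    heckeUp t m le_rfl
        (X (Fin.last m) * rotPoly q (homogeneousComponent (size α) (G q t α))) =
      (barC q t α 0)⁻¹ • (X 0 * homogeneousComponent (size α) (G q t α)) := by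
  have h1 := congrArg (homogeneousComponent (size α + 1)) (h.cherednik_G α)
  rwa [map_add, totalDegree_le_iff.1 (h.totalDegree_G_le α) _ (Nat.lt_succ_self _), zero_add,
    isGraded_heckeUp, top_raise (h.totalDegree_G_le α), map_smul, homogeneousComponent_X_mul] at h1

theorem IsGeneric.heckeUp_injective (h : IsGeneric q t) {p r : MvPolynomial (Fin (m + 1)) k}
    (hpr : heckeUp t m le_rfl p = heckeUp t m le_rfl r) : p = r := by
  have := congrArg (heckeUpInv t m le_rfl) hpr
  rwa [← Module.End.mul_apply, ← Module.End.mul_apply, heckeUpInv_mul_heckeUp h.t_ne_zero] at this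

/-- The eigenvalue equation and `T_0 ⋯ T_{m-1} x_n T_{m-1} ⋯ T_0 = t ^ m x_1` both compute multiples
of `x_1` times the top component; cancel `T_0 ⋯ T_{m-1}` and `x_n`. -/
theorem IsGeneric.heckeDown_top (h : IsGeneric q t) (α : Fin (m + 1) → ℕ) :
    heckeDown t m le_rfl (homogeneousComponent (size α) (G q t α)) =
      (t ^ m * barC q t α 0) • rotPoly q (homogeneousComponent (size α) (G q t α)) := by
  have h0 := h.barC_ne_zero α 0
  refine mul_left_cancel₀ (X_ne_zero (Fin.last m)) (h.heckeUp_injective ?_)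
  have h1 := heckeUp_X_mul_heckeDown t m le_rfl (homogeneousComponent (size α) (G q t α))
  rw [mul_smul_comm, map_smul, h.cherednik_top, smul_smul, mul_assoc, mul_inv_cancel₀ h0, mul_one]
  exact h1

/-- `G'_α` is an eigenfunction of a primed inhomogeneous Cherednik operator. -/
theorem IsGeneric.cherednik_GPrime (h : IsGeneric q t) (α : Fin (m + 1) → ℕ) :
    raiseInv m q (heckeDown t m le_rfl (GPrime q t α)) +
        (t ^ m)⁻¹ • heckeUp t m le_rfl (heckeDown t m le_rfl (GPrime q t α)) =
      (t ^ m * barC q t α 0) • (X 0 * GPrime q t α) := by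
  have ht := pow_ne_zero m h.t_ne_zero
  have hdeg := (isGraded_heckeDown t m le_rfl).totalDegree_le (h.totalDegree_GPrime_le α)
  have hvan := (h.vanishesNeg_GPrime α).heckeDown h m le_rfl
  have hdeg' := (isGraded_heckeUp t m le_rfl).totalDegree_le hdeg
  have htop : homogeneousComponent (size α) (heckeDown t m le_rfl (GPrime q t α)) =
      (t ^ m * barC q t α 0) • rotPoly q (homogeneousComponent (size α) (G q t α)) := by
    rw [isGraded_heckeDown, h.top_GPrime, h.heckeDown_top]
  set p := heckeDown t m le_rfl (GPrime q t α) with hp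
  obtain ⟨r, hr⟩ : X 0 ∣ raiseInv m q p + (t ^ m)⁻¹ • heckeUp t m le_rfl p := by
    refine X_zero_dvd_of_shiftZero ?_
    have h0 : shiftZero (k := k) (m := m) 0 (X 0) = 0 := by simp [shiftZero]
    rw [map_add, map_smul, shiftZero_heckeUp, raiseInv_apply, map_mul, map_sub, h0,
      shiftZero_zero_rotPolyInv, smul_smul, inv_mul_cancel₀ ht, map_one]
    simp
  rw [hr, ← mul_smul_comm]
  congr 1
  have hrdeg : r.totalDegree ≤ size α := by
    refine totalDegree_of_X_mul (i := 0)
      (hr ▸ totalDegree_add_le_of_le (totalDegree_raiseInv_le _ hdeg) ?_)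
    exact totalDegree_smul_le_of_le (hdeg'.trans (Nat.le_succ _)) _
  refine h.eq_smul_GPrime hrdeg ?_ fun v hv hd => ?_
  -- Only the raised term reaches degree `|α| + 1`; there the two mutually inverse rotations cancel
  -- and restore the top component of `G_α`.
  · refine mul_left_cancel₀ (X_ne_zero (0 : Fin (m + 1))) ?_
    rw [← homogeneousComponent_X_mul, ← hr, map_add, map_smul, top_raiseInv hdeg, htop, map_smul,
      rotPolyInv_rotPoly h.q_ne_zero, totalDegree_le_iff.1 hdeg' _ (Nat.lt_succ_self _), smul_zero,
      add_zero]
  · have h1 := congrArg (eval (bar q t v)) hr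
    rw [(((hvan.raiseInv h).mono (Nat.le_succ _)).add ((hvan.heckeUp h m le_rfl).smul _)) v hv hd,
      map_mul, eval_X] at h1
    exact (mul_eq_zero.1 h1.symm).resolve_left (h.bar_ne_zero v 0)

/-- The raising operator for the polynomials `G'_α`. -/
def raisePrime (m : ℕ) (q t : k) : Module.End k (MvPolynomial (Fin (m + 1)) k) :=
  heckeUpInv t m le_rfl * raiseInv m q * heckeDown t m le_rfl

/-- In this form no rotation is left, so the value at multiples of `τ` and the top component can be
read off. -/
theorem IsGeneric.raisePrime_GPrime (h : IsGeneric q t) (α : Fin (m + 1) → ℕ) :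
    raisePrime m q t (GPrime q t α) =
      (t ^ m * barC q t α 0) • heckeUpInv t m le_rfl (X 0 * GPrime q t α) -
        (t ^ m)⁻¹ • heckeDown t m le_rfl (GPrime q t α) := by
  rw [raisePrime, Module.End.mul_apply, Module.End.mul_apply,
    eq_sub_of_add_eq (h.cherednik_GPrime α), map_sub, map_smul, map_smul,
    ← Module.End.mul_apply (heckeUpInv t m le_rfl) (heckeUp t m le_rfl),
    heckeUpInv_mul_heckeUp h.t_ne_zero, Module.End.one_apply]

theorem IsGeneric.eval_raisePrime_GPrime (h : IsGeneric q t) (α : Fin (m + 1) → ℕ) {c : k}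
    (hc : c ≠ 0) : eval (c • bar q t 0) (raisePrime m q t (GPrime q t α)) =
      (c * barC q t α 0 - 1) * eval (c • bar q t 0) (GPrime q t α) := by
  have ht := pow_ne_zero m h.t_ne_zero
  have h0 : bar q t (0 : Fin (m + 1) → ℤ) 0 = 1 := by simp [bar_zero, tauVec]
  rw [h.raisePrime_GPrime, map_sub, smul_eval, smul_eval, h.eval_heckeUpInv_tau hc,
    h.eval_heckeDown_tau hc, map_mul, eval_X, Pi.smul_apply, h0, smul_eq_mul]
  field_simp

/-- The extra zeros come from `x_1 - 1`. In the constant, `t ^ m ᾱ_1` comes from the eigenvalue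
equation of `G'_α`, the second `ᾱ_1` from inverting that of the top component of `G_α`, and `c` from
raising `G_α`. -/
theorem IsGeneric.raisePrime_GPrime_eq (h : IsGeneric q t) (α : Fin (m + 1) → ℕ) {c : k}
    (hc : raise q t (G q t α) = c • G q t (rotC α)) :
    raisePrime m q t (GPrime q t α) = (t ^ m * barC q t α 0 ^ 2 * c) • GPrime q t (rotC α) := by
  have h0 := h.barC_ne_zero α 0
  have hdeg := (isGraded_heckeDown t m le_rfl).totalDegree_le (h.totalDegree_GPrime_le α)
  refine h.eq_smul_GPrime ?_ ?_ ?_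
  · rw [size_rotC]
    exact (isGraded_heckeUpInv t m le_rfl).totalDegree_le (totalDegree_raiseInv_le _ hdeg)
  · rw [size_rotC, h.raisePrime_GPrime, map_sub, map_smul, map_smul, isGraded_heckeUpInv,
      homogeneousComponent_X_mul, h.top_GPrime, totalDegree_le_iff.1 hdeg _ (Nat.lt_succ_self _),
      smul_zero, sub_zero, mul_smul _ c,
      ← map_smul (homogeneousComponent (size α + 1)) c, ← hc, top_raise (h.totalDegree_G_le α)]
    have h1 := congrArg (heckeUpInv t m le_rfl) (h.cherednik_top α)
    rw [← Module.End.mul_apply, heckeUpInv_mul_heckeUp h.t_ne_zero, Module.End.one_apply,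
      map_smul] at h1
    rw [h1, smul_smul]
    congr 1
    field_simp
  · rw [size_rotC]
    exact ((((h.vanishesNeg_GPrime α).heckeDown h m le_rfl).raiseInv h).heckeUpInv h m le_rfl)

theorem IsGeneric.eval_raise_G (h : IsGeneric q t) (α : Fin (m + 1) → ℕ) {c : k} (hc : c ≠ 0) :
    t ^ m * eval (c • bar q t 0) (raise q t (G q t α)) =
      (c * (barC q t α 0)⁻¹ - 1) * eval (c • bar q t 0) (G q t α) := by
  have h0 : bar q t (0 : Fin (m + 1) → ℤ) 0 = 1 := by simp [bar_zero, tauVec]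
  have h1 := congrArg (eval (c • bar q t 0)) (h.cherednik_G α)
  rw [map_add, h.eval_heckeUp_tau hc, smul_eval, map_mul, eval_X, Pi.smul_apply, h0, smul_eq_mul]
    at h1
  linear_combination h1

end Recursion

/-! ### Induction over compositions -/

section Induction

variable {m : ℕ}

/-- Every composition is obtained from `0` by adjacent transpositions and affine rotations. -/
theorem composition_induction {P : (Fin (m + 1) → ℕ) → Prop} (h0 : P 0)
    (hadj : ∀ α i, P α → P (α ∘ adj i)) (hrot : ∀ α, P α → P (rotC α)) (α : Fin (m + 1) → ℕ) :
    P α := by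
  induction hd : size α generalizing α with
  | zero =>
    have : α = 0 := funext fun i => by
      have := le_size α i
      simp only [Pi.zero_apply]
      omega
    rwa [this]
  | succ d ih =>
    -- Adjacent swaps carry a nonzero entry from position `i` to the last position, where the
    -- composition is a rotation of a smaller one.
    have key : ∀ i : Fin (m + 1), ∀ α : Fin (m + 1) → ℕ, size α = d + 1 → α i ≠ 0 → P α := by
      intro i
      induction i using Fin.reverseInduction with
      | last =>
        intro α hα hi
        obtain ⟨β, rfl⟩ := exists_rotC hi
        rw [size_rotC] at hα
        exact hrot β (ih β (by omega))
      | cast i hi =>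
        intro α hα hαi
        have := hadj _ i (hi (α ∘ adj i) (by rwa [size_comp_adj]) (by simpa [adj_succ] using hαi))
        rwa [show (α ∘ adj i) ∘ adj i = α from funext fun j => by simp [adj_adj]] at this
    obtain ⟨i, hi⟩ : ∃ i, α i ≠ 0 := by
      by_contra! hall
      simp [size, hall] at hd
    exact key i α hd hi

end Induction

end

section

/-! ### The statistics in `τ_β` -/

section Statistics

/-- `∑_{i, j} min(α_i, α_j)`. -/
def minSum {n : ℕ} (α : Fin n → ℕ) : ℕ := ∑ i, ∑ j, min (α i) (α j)

theorem nStat_of_antitone {n : ℕ} {α : Fin n → ℕ} (hα : Antitone α) :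
    nStat α = ∑ i, ∑ j, if i < j then min (α i) (α j) else 0 := by
  rw [nStat]
  refine Finset.sum_congr rfl fun i _ => ?_
  have h1 (l : ℕ) : leg α i l = ∑ j, if i < j ∧ l ≤ α j then 1 else 0 := by
    have h2 : (Finset.univ.filter fun k : Fin n => k < i ∧ l ≤ α k + 1 ∧ α k + 1 ≤ α i) = ∅ := by
      rw [Finset.filter_eq_empty_iff]
      rintro j - ⟨h3, -, h4⟩
      have := hα h3.le
      omega
    rw [leg, h2, Finset.card_empty, add_zero, Finset.card_filter]
    refine Finset.sum_congr rfl fun j _ => if_congr ⟨fun h => ⟨h.1, h.2.1⟩, fun h => ⟨h.1, h.2, ?_⟩⟩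
      rfl rfl
    exact hα h.1.le
  simp only [h1]
  rw [Finset.sum_comm]
  refine Finset.sum_congr rfl fun j _ => ?_
  split_ifs with hij
  · have h3 : (Finset.Icc 1 (α i)).filter (fun l => l ≤ α j) = Finset.Icc 1 (α j) := by
      ext l
      have := hα hij.le
      simp only [Finset.mem_filter, Finset.mem_Icc]
      omega
    simp only [hij, true_and]
    rw [← Finset.card_filter, h3, Nat.card_Icc, min_eq_right (hα hij.le)]
    omega
  · simp [hij]

theorem minSum_of_antitone {n : ℕ} {α : Fin n → ℕ} (hα : Antitone α) :
    minSum α = 2 * nStat α + size α := by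
  have h1 (i j : Fin n) : min (α i) (α j) = (if i < j then min (α i) (α j) else 0) +
      (if j < i then min (α j) (α i) else 0) + if i = j then α i else 0 := by
    rcases lt_trichotomy i j with h | h | h
    · simp [h, h.not_gt, h.ne]
    · simp [h]
    · simp [h, h.not_gt, h.ne', min_comm]
  rw [minSum]
  conv_lhs => enter [2, i, 2, j]; rw [h1]
  simp only [Finset.sum_add_distrib]
  rw [Finset.sum_comm (f := fun i j => if j < i then min (α j) (α i) else 0), nStat_of_antitone hα,
    size]
  simp
  ring

theorem minSum_comp {n : ℕ} (α : Fin n → ℕ) (e : Equiv.Perm (Fin n)) :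
    minSum (α ∘ e) = minSum α := by
  rw [minSum, minSum, ← Equiv.sum_comp e fun i => ∑ j, min (α i) (α j)]
  exact Finset.sum_congr rfl fun i _ => Equiv.sum_comp e fun j => min (α (e i)) (α j)

/-- The sum of minima is invariant under permutations, so it computes `n(α⁺)` without sorting. -/
theorem two_mul_nStat_decr {n : ℕ} (α : Fin n → ℕ) :
    2 * nStat (decr α) + size α = minSum α := by
  have h1 : Antitone (decr α) := fun i j hij =>
    Tuple.monotone_sort α (Fin.rev_le_rev.2 hij)
  have h2 : decr α = α ∘ (Fin.revPerm.trans (Tuple.sort α)) := rfl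
  have h3 : size (decr α) = size α := by
    rw [h2]
    exact Equiv.sum_comp (Fin.revPerm.trans (Tuple.sort α)) α
  rw [← h3, ← minSum_of_antitone h1, h2, minSum_comp]

variable {m : ℕ}

theorem kStat_zero (α : Fin (m + 1) → ℕ) :
    kStat (fun i => (α i : ℤ)) 0 = ∑ j : Fin m, if α 0 < α j.succ then 1 else 0 := by
  rw [kStat_eq_sum, Fin.sum_univ_succ]
  simp

/-- Raising the first part by one increases its minimum with another part exactly when that part is
larger; each such pair counts twice and the diagonal once. -/
theorem minSum_rotC (α : Fin (m + 1) → ℕ) :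
    minSum (rotC α) = minSum α + 2 * kStat (fun i => (α i : ℤ)) 0 + 1 := by
  have h1 (x y : ℕ) : min x (y + 1) = min x y + if y < x then 1 else 0 := by
    split_ifs <;> omega
  have h2 : minSum (rotC α) = ∑ i : Fin m, ∑ j : Fin m, min (α i.succ) (α j.succ) +
      ∑ i : Fin m, min (α i.succ) (α 0 + 1) +
      (∑ j : Fin m, min (α j.succ) (α 0 + 1) + (α 0 + 1)) := by
    simp only [minSum, Fin.sum_univ_castSucc, rotC, rotate_castSucc, rotate_last,
      Finset.sum_add_distrib, min_self, min_comm (α 0 + 1)]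
  have h3 : minSum α = α 0 + ∑ j : Fin m, min (α j.succ) (α 0) +
      (∑ i : Fin m, min (α i.succ) (α 0) +
        ∑ i : Fin m, ∑ j : Fin m, min (α i.succ) (α j.succ)) := by
    simp only [minSum, Fin.sum_univ_succ (n := m), Finset.sum_add_distrib, min_self, min_comm (α 0)]
  rw [h2, h3, kStat_zero]
  simp only [h1, Finset.sum_add_distrib]
  ring

theorem nStat_decr_rotC (α : Fin (m + 1) → ℕ) :
    nStat (decr (rotC α)) = nStat (decr α) + kStat (fun i => (α i : ℤ)) 0 := by
  have h1 := two_mul_nStat_decr α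
  have h2 := two_mul_nStat_decr (rotC α)
  rw [minSum_rotC, size_rotC] at h2
  omega

theorem nStat_decr_comp {n : ℕ} (α : Fin n → ℕ) (e : Equiv.Perm (Fin n)) :
    nStat (decr (α ∘ e)) = nStat (decr α) := by
  have h1 := two_mul_nStat_decr α
  have h2 := two_mul_nStat_decr (α ∘ e)
  have h3 : size (α ∘ e) = size α := Equiv.sum_comp e α
  rw [minSum_comp] at h2
  omega

theorem nStatPrime_rotC (α : Fin (m + 1) → ℕ) : nStatPrime (rotC α) = nStatPrime α + α 0 := by
  have h1 (a : ℕ) : ∑ j ∈ Finset.Icc 1 (a + 1), (a + 1 - j) =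
      ∑ j ∈ Finset.Icc 1 a, (a - j) + a := by
    rw [Finset.sum_Icc_succ_top (by omega), Nat.sub_self, add_zero]
    have : ∀ j ∈ Finset.Icc 1 a, a + 1 - j = (a - j) + 1 := fun j hj => by
      have := (Finset.mem_Icc.1 hj).2
      omega
    rw [Finset.sum_congr rfl this, Finset.sum_add_distrib]
    simp
  rw [nStatPrime, nStatPrime, Fin.sum_univ_castSucc, Fin.sum_univ_succ]
  simp only [rotC, rotate_castSucc, rotate_last, h1]
  ring

variable {k : Type*} [Field k] {q t : k}

theorem tauC_comp_adj (α : Fin (m + 1) → ℕ) (i : Fin m) :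
    tauC q t (α ∘ adj i) = tauC q t α := by
  have : nStatPrime (α ∘ adj i) = nStatPrime α :=
    Equiv.sum_comp (adj i) fun i => ∑ j ∈ Finset.Icc 1 (α i), (α i - j)
  rw [tauC, tauC, size_comp_adj, nStat_decr_comp, this]

/-- The exponent of `q` grows by `α 0`, and that of `t⁻¹` by `k_1(α)`: together these are the first
coordinate of `ᾱ`. -/
theorem tauC_rotC (α : Fin (m + 1) → ℕ) :
    tauC q t (rotC α) = -(barC q t α 0) * tauC q t α := by
  rw [tauC, tauC, size_rotC, nStatPrime_rotC, nStat_decr_rotC, barC, bar, zpow_natCast]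
  simp only [pow_add, mul_inv]
  ring

theorem tauC_zero {n : ℕ} : tauC q t (0 : Fin n → ℕ) = 1 := by
  have h : decr (0 : Fin n → ℕ) = 0 := rfl
  simp [tauC, h, nStat, nStatPrime, size]

end Statistics

/-! ### Comparison of the normalizations at multiples of `τ` -/

section Normalization

variable {k : Type*} [Field k] {q t : k}

theorem IsGeneric.G_zero {n : ℕ} (h : IsGeneric q t) : G q t (0 : Fin n → ℕ) = 1 := by
  refine (h.existsUnique_isInterpolation 0).unique (h.isInterpolation_G 0) ⟨?_, ?_, ?_⟩
  · simp
  · intro β hβ hne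
    refine absurd (funext fun i => ?_) hne
    have := le_size β i
    have h0 : size (0 : Fin n → ℕ) = 0 := by simp [size]
    simp only [Pi.zero_apply]
    omega
  · have : expo (0 : Fin n → ℕ) = 0 := by ext; simp [expo]
    change coeff (expo 0) 1 = 1
    rw [this, coeff_zero_one]

theorem IsGeneric.GPrime_zero {n : ℕ} (h : IsGeneric q t) : GPrime q t (0 : Fin n → ℕ) = 1 := by
  refine (h.existsUnique_isPrimedInterpolation 0).unique (h.isPrimedInterpolation_GPrime 0)
    ⟨?_, ?_, ?_⟩
  · simp
  · rw [h.G_zero]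
  · intro β hβ
    have h0 : size (0 : Fin n → ℕ) = 0 := by simp [size]
    omega

/-- `a` is not a monomial in `q` and `t`. -/
def IsGenericOver (q t a : k) : Prop := a ≠ 0 ∧ ∀ i j : ℤ, a ≠ q ^ i * t ^ j

theorem IsGenericOver.ne_barC {a : k} (ha : IsGenericOver q t a) {n : ℕ} (α : Fin n → ℕ)
    (i : Fin n) : a ≠ barC q t α i := by
  rw [barC, IsGeneric.bar_eq]
  exact ha.2 _ _

/-- Nonvanishing of the normalizations of `G_α` and `G'_α`, and their ratio. -/
theorem IsGeneric.normalization (h : IsGeneric q t) {a : k} (ha : IsGenericOver q t a) {n : ℕ}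
    (α : Fin n → ℕ) : eval (a • bar q t 0) (G q t α) ≠ 0 ∧
      eval (a⁻¹ • bar q t 0) (GPrime q t α) ≠ 0 ∧
      eval (a • bar q t 0) (G q t α) =
        tauC q t α * a ^ size α * eval (a⁻¹ • bar q t 0) (GPrime q t α) := by
  have ha0 := ha.1
  have h0 : ∀ n : ℕ, eval (a • bar q t 0) (G q t (0 : Fin n → ℕ)) ≠ 0 ∧
      eval (a⁻¹ • bar q t 0) (GPrime q t (0 : Fin n → ℕ)) ≠ 0 ∧
      eval (a • bar q t 0) (G q t (0 : Fin n → ℕ)) = tauC q t (0 : Fin n → ℕ) *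
        a ^ size (0 : Fin n → ℕ) * eval (a⁻¹ • bar q t 0) (GPrime q t (0 : Fin n → ℕ)) := by
    intro n
    rw [h.G_zero, h.GPrime_zero, tauC_zero]
    simp [size]
  cases n with
  | zero => rw [Subsingleton.elim α 0]; exact h0 0
  | succ m =>
  induction α using composition_induction with
  | h0 => exact h0 _
  | hadj α i ih =>
    by_cases hα : α i.castSucc = α i.succ
    · rwa [comp_adj_eq_self hα]
    obtain ⟨ih1, ih2, ih3⟩ := ih
    obtain ⟨b, hb, hb'⟩ := h.exists_hecke_G α i
    have hA := h.diagCoeff_ne (v := fun j => (α j : ℤ)) (i := i) (by exact_mod_cast hα)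
    set A := diagCoeff q t (fun j => (α j : ℤ)) i
    -- As `T_i` acts by `t` under both evaluations, the two values change by the same factor `(t -
    -- A) / b`.
    have e1 := (h.eval_hecke_tau ha0 i (G q t α)).1
    have e2 := (h.eval_hecke_tau (inv_ne_zero ha0) i (GPrime q t α)).1
    rw [hb, map_add, smul_eval, smul_eval] at e1
    rw [hb', map_add, smul_eval, smul_eval] at e2
    have f1 : b * eval (a • bar q t 0) (G q t (α ∘ adj i)) =
        (t - A) * eval (a • bar q t 0) (G q t α) := by linear_combination e1
    have f2 : b * eval (a⁻¹ • bar q t 0) (GPrime q t (α ∘ adj i)) =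
        (t - A) * eval (a⁻¹ • bar q t 0) (GPrime q t α) := by linear_combination e2
    have g1 := mul_ne_zero hA ih1
    have g2 := mul_ne_zero hA ih2
    rw [← f1] at g1
    rw [← f2] at g2
    refine ⟨right_ne_zero_of_mul g1, right_ne_zero_of_mul g2, ?_⟩
    refine mul_left_cancel₀ (left_ne_zero_of_mul g1) ?_
    rw [f1, tauC_comp_adj, size_comp_adj, ih3]
    linear_combination -(tauC q t α * a ^ size α) * f2
  | hrot α ih =>
    obtain ⟨ih1, ih2, ih3⟩ := ih
    obtain ⟨c, hc0, hc⟩ := h.exists_raise_G α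
    have hb := h.barC_ne_zero α 0
    have hab := sub_ne_zero.2 (ha.ne_barC α 0)
    have ht := pow_ne_zero m h.t_ne_zero
    have e1 := h.eval_raise_G α ha0
    have e2 := h.eval_raisePrime_GPrime α (inv_ne_zero ha0)
    rw [hc, smul_eval] at e1
    rw [h.raisePrime_GPrime_eq α hc, smul_eval] at e2
    rw [tauC_rotC, size_rotC]
    set b := barC q t α 0
    -- The quotient of the two recursions is `-(a * b)`, exactly the growth of `τ_α a^|α|` under
    -- rotation.
    have f1 : t ^ m * c * b * eval (a • bar q t 0) (G q t (rotC α)) =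
        (a - b) * eval (a • bar q t 0) (G q t α) := by
      have : (a - b) = b * (a * b⁻¹ - 1) := by field_simp
      rw [this]
      linear_combination b * e1
    have f2 : a * (t ^ m * b ^ 2 * c) * eval (a⁻¹ • bar q t 0) (GPrime q t (rotC α)) =
        -(a - b) * eval (a⁻¹ • bar q t 0) (GPrime q t α) := by
      have : -(a - b) = a * (a⁻¹ * b - 1) := by field_simp; ring
      rw [this]
      linear_combination a * e2
    have g1 := mul_ne_zero hab ih1
    have g2 := mul_ne_zero (neg_ne_zero.2 hab) ih2
    rw [← f1] at g1
    rw [← f2] at g2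
    refine ⟨right_ne_zero_of_mul g1, right_ne_zero_of_mul g2, ?_⟩
    refine mul_left_cancel₀ (left_ne_zero_of_mul g1) ?_
    rw [f1, ih3]
    linear_combination (tauC q t α * a ^ size α) * f2

end Normalization

end

section

variable {k : Type*} [Field k]

/-! ### Adjoint operators and duality -/

section Duality

/-- The polynomial `G'_α(x) / G'_α(a⁻¹ τ)`. -/
def normPrime (q t a : k) {n : ℕ} (α : Fin n → ℕ) : MvPolynomial (Fin n) k :=
  (eval (a⁻¹ • bar q t 0) (GPrime q t α))⁻¹ • GPrime q t α

variable {q t a : k} {m : ℕ}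

theorem IsGeneric.eval_normPrime (h : IsGeneric q t) (ha : IsGenericOver q t a) {n : ℕ}
    (α : Fin n → ℕ) : eval (a⁻¹ • bar q t 0) (normPrime q t a α) = 1 := by
  rw [normPrime, smul_eval, inv_mul_cancel₀ (h.normalization ha α).2.1]

/-- Evaluation at `a⁻¹τ`, where normalized polynomials are `1` and `T_i` acts by `t`, determines the
unknown constant. The coefficients become those of the action on values. -/
theorem IsGeneric.hecke_normPrime (h : IsGeneric q t) (ha : IsGenericOver q t a)
    (α : Fin (m + 1) → ℕ) (i : Fin m) : hecke t i (normPrime q t a α) =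
      diagCoeff q t (fun j => (α j : ℤ)) i • normPrime q t a α +
        (t - diagCoeff q t (fun j => (α j : ℤ)) i) • normPrime q t a (α ∘ adj i) := by
  obtain ⟨b, -, hb⟩ := h.exists_hecke_G α i
  have h1 := (h.normalization ha α).2.1
  have h2 := (h.normalization ha (α ∘ adj i)).2.1
  have e := (h.eval_hecke_tau (inv_ne_zero ha.1) i (GPrime q t α)).1
  rw [hb, map_add, smul_eval, smul_eval] at e
  rw [normPrime, normPrime, map_smul, hb, smul_add, smul_comm]
  congr 1
  rw [smul_smul, smul_smul]
  congr 1
  generalize eval (a⁻¹ • bar q t 0) (GPrime q t α) = x at *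
  generalize eval (a⁻¹ • bar q t 0) (GPrime q t (α ∘ adj i)) = y at *
  field_simp
  linear_combination e

theorem IsGeneric.raisePrime_normPrime (h : IsGeneric q t) (ha : IsGenericOver q t a)
    (α : Fin (m + 1) → ℕ) : raisePrime m q t (normPrime q t a α) =
      (a⁻¹ * barC q t α 0 - 1) • normPrime q t a (rotC α) := by
  obtain ⟨c, -, hc⟩ := h.exists_raise_G α
  have h1 := (h.normalization ha α).2.1
  have h2 := (h.normalization ha (rotC α)).2.1
  have e := h.eval_raisePrime_GPrime α (inv_ne_zero ha.1)
  rw [h.raisePrime_GPrime_eq α hc, smul_eval] at e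
  rw [normPrime, normPrime, map_smul, h.raisePrime_GPrime_eq α hc, smul_smul, smul_smul]
  congr 1
  generalize eval (a⁻¹ • bar q t 0) (GPrime q t α) = x at *
  generalize eval (a⁻¹ • bar q t 0) (GPrime q t (rotC α)) = y at *
  rw [← div_eq_inv_mul, div_eq_iff h1, (eq_mul_inv_iff_mul_eq₀ h2).2 e]
  ring

variable (q t a) in
/-- The linear map sending the basis vector at `α` to the normalized polynomial at `α`. -/
def realize {n : ℕ} : ((Fin n → ℕ) →₀ k) →ₗ[k] MvPolynomial (Fin n) k :=
  Finsupp.linearCombination k (normPrime q t a)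

variable (q t a) in
/-- Evaluation of a polynomial at a combination of the points `a⁻¹ β̄`. -/
def pairing {n : ℕ} (p : MvPolynomial (Fin n) k) : ((Fin n → ℕ) →₀ k) →ₗ[k] k :=
  Finsupp.linearCombination k fun β => eval (a⁻¹ • barC q t β) p

theorem pairing_sub {n : ℕ} (p r : MvPolynomial (Fin n) k) :
    pairing q t a (p - r) = pairing q t a p - pairing q t a r := by
  ext β
  simp [pairing]

theorem pairing_smul {n : ℕ} (c : k) (p : MvPolynomial (Fin n) k) :
    pairing q t a (c • p) = c • pairing q t a p := by
  ext β
  simp [pairing]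

variable (q t a) in
/-- The operator `O` acts on the normalized polynomials by `w` on the indices, and `O'` acts on
values by `w` on the points. -/
structure IsAdjoint {n : ℕ} (O O' : Module.End k (MvPolynomial (Fin n) k))
    (w : Module.End k ((Fin n → ℕ) →₀ k)) : Prop where
  realize : ∀ v, O (realize q t a v) = realize q t a (w v)
  pairing : ∀ p v, pairing q t a (O' p) v = pairing q t a p (w v)

theorem IsAdjoint.mul {n : ℕ} {O₁ O₁' O₂ O₂' : Module.End k (MvPolynomial (Fin n) k)}
    {w₁ w₂ : Module.End k ((Fin n → ℕ) →₀ k)} (h₁ : IsAdjoint q t a O₁ O₁' w₁)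
    (h₂ : IsAdjoint q t a O₂ O₂' w₂) : IsAdjoint q t a (O₁ * O₂) (O₂' * O₁') (w₁ * w₂) where
  realize v := by
    rw [Module.End.mul_apply, h₂.realize, h₁.realize, Module.End.mul_apply]
  pairing p v := by
    rw [Module.End.mul_apply, h₂.pairing, h₁.pairing, Module.End.mul_apply]

theorem isAdjoint_one {n : ℕ} :
    IsAdjoint q t a (1 : Module.End k (MvPolynomial (Fin n) k)) 1 1 :=
  ⟨fun _ => rfl, fun _ _ => rfl⟩

/-- It suffices to check adjointness on basis vectors. -/
theorem isAdjoint_of_single {n : ℕ} {O O' : Module.End k (MvPolynomial (Fin n) k)}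
    {w : (Fin n → ℕ) → (Fin n → ℕ) →₀ k}
    (h1 : ∀ α, O (normPrime q t a α) = realize q t a (w α))
    (h2 : ∀ p α, eval (a⁻¹ • barC q t α) (O' p) = pairing q t a p (w α)) :
    IsAdjoint q t a O O' (Finsupp.linearCombination k w) where
  realize v := by
    have : O ∘ₗ realize q t a = realize q t a ∘ₗ Finsupp.linearCombination k w := by
      ext1 α
      ext1
      simp [realize, h1]
    exact LinearMap.congr_fun this v
  pairing p v := by
    have : pairing q t a (O' p) = pairing q t a p ∘ₗ Finsupp.linearCombination k w := by
      ext α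
      simp [pairing, h2]
    exact LinearMap.congr_fun this v

theorem IsGeneric.isAdjoint_hecke (h : IsGeneric q t) (ha : IsGenericOver q t a) (i : Fin m) :
    IsAdjoint q t a (hecke t i) (hecke t i) (Finsupp.linearCombination k fun α =>
      diagCoeff q t (fun j => (α j : ℤ)) i • Finsupp.single α 1 +
        (t - diagCoeff q t (fun j => (α j : ℤ)) i) • Finsupp.single (α ∘ adj i) 1) := by
  refine isAdjoint_of_single (fun α => ?_) fun p α => ?_
  · rw [h.hecke_normPrime ha]
    simp only [realize, map_add, map_smul, Finsupp.linearCombination_single, one_smul]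
  · have := h.eval_hecke (inv_ne_zero ha.1) (fun j => (α j : ℤ)) i p
    simp only [map_add, map_smul, pairing, Finsupp.linearCombination_single, smul_eq_mul, one_mul]
    exact this

theorem IsGeneric.isAdjoint_raisePrime (h : IsGeneric q t) (ha : IsGenericOver q t a) :
    IsAdjoint q t a (raisePrime m q t) (raiseInv m q) (Finsupp.linearCombination k fun α =>
      (a⁻¹ * barC q t α 0 - 1) • Finsupp.single (rotC α) 1) := by
  refine isAdjoint_of_single (fun α => ?_) fun p α => ?_
  · rw [h.raisePrime_normPrime ha]
    simp only [realize, map_smul, Finsupp.linearCombination_single, one_smul]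
  · have := h.eval_raiseInv a⁻¹ (fun j => (α j : ℤ)) p
    rw [← cast_rotC] at this
    simp only [map_smul, pairing, Finsupp.linearCombination_single, smul_eq_mul, one_mul]
    exact this

theorem IsAdjoint.heckeInv {i : Fin m} {w : Module.End k ((Fin (m + 1) → ℕ) →₀ k)}
    (hw : IsAdjoint q t a (hecke t i) (hecke t i) w) :
    IsAdjoint q t a (heckeInv t i) (heckeInv t i) (t⁻¹ • (w - (t - 1) • 1)) where
  realize v := by
    rw [heckeInv_apply, hw.realize]
    simp
  pairing p v := by
    rw [heckeInv_apply, pairing_smul, pairing_sub, pairing_smul]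
    simp [hw.pairing]

theorem IsGeneric.exists_isAdjoint_heckeUp (h : IsGeneric q t) (ha : IsGenericOver q t a) :
    ∀ j (hj : j ≤ m), ∃ w, IsAdjoint q t a (heckeUp t j hj) (heckeDown t j hj) w
  | 0, _ => ⟨1, isAdjoint_one⟩
  | j + 1, hj => by
    obtain ⟨w, hw⟩ := h.exists_isAdjoint_heckeUp ha j (Nat.le_of_succ_le hj)
    exact ⟨_, hw.mul (h.isAdjoint_hecke ha ⟨j, hj⟩)⟩

theorem IsGeneric.exists_isAdjoint_heckeDownInv (h : IsGeneric q t) (ha : IsGenericOver q t a) :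
    ∀ j (hj : j ≤ m), ∃ w, IsAdjoint q t a (heckeDownInv t j hj) (heckeUpInv t j hj) w
  | 0, _ => ⟨1, isAdjoint_one⟩
  | j + 1, hj => by
    obtain ⟨w, hw⟩ := h.exists_isAdjoint_heckeDownInv ha j (Nat.le_of_succ_le hj)
    exact ⟨_, hw.mul (h.isAdjoint_hecke ha ⟨j, hj⟩).heckeInv⟩

/-- The two raising operators differ by invertible Hecke factors. Solving for the other one and
reversing the order of the adjoints exchanges their roles. -/
theorem IsGeneric.exists_isAdjoint_raiseInv (h : IsGeneric q t) (ha : IsGenericOver q t a) :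
    ∃ w, IsAdjoint q t a (raiseInv m q) (raisePrime m q t) w := by
  obtain ⟨w₁, h₁⟩ := h.exists_isAdjoint_heckeUp (m := m) ha m le_rfl
  obtain ⟨w₂, h₂⟩ := h.exists_isAdjoint_heckeDownInv (m := m) ha m le_rfl
  have h₃ := (h₁.mul (h.isAdjoint_raisePrime ha)).mul h₂
  have ht := h.t_ne_zero
  have e : heckeUp t m le_rfl * raisePrime m q t * heckeDownInv t m le_rfl = raiseInv m q := by
    rw [raisePrime, mul_assoc, mul_assoc, heckeDown_mul_heckeDownInv ht, mul_one, ← mul_assoc,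
      heckeUp_mul_heckeUpInv ht, one_mul]
  rw [e, ← mul_assoc] at h₃
  exact ⟨_, h₃⟩

variable (q t a) in
/-- The vectors `u` for which the form `(u, v) ↦ ⟨κ(u), v⟩` is symmetric. -/
def IsSymm {n : ℕ} (u : (Fin n → ℕ) →₀ k) : Prop :=
  ∀ v, pairing q t a (realize q t a u) v = pairing q t a (realize q t a v) u

/-- The operator moves from the index to the point by `h'`, symmetry of `u` swaps the arguments, and
the same is done backwards with `O'`. -/
theorem IsSymm.of_isAdjoint {n : ℕ} {u : (Fin n → ℕ) →₀ k} (hu : IsSymm q t a u)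
    {O O' : Module.End k (MvPolynomial (Fin n) k)} {w w' : Module.End k ((Fin n → ℕ) →₀ k)}
    (h : IsAdjoint q t a O O' w) (h' : IsAdjoint q t a O' O w') : IsSymm q t a (w u) := fun v => by
  rw [← h.realize, h'.pairing, hu, ← h'.realize, h.pairing]

theorem IsSymm.sub {n : ℕ} {u u' : (Fin n → ℕ) →₀ k} (hu : IsSymm q t a u)
    (hu' : IsSymm q t a u') : IsSymm q t a (u - u') := fun v => by
  rw [map_sub, pairing_sub, map_sub, LinearMap.sub_apply, hu, hu']

theorem IsSymm.smul {n : ℕ} {u : (Fin n → ℕ) →₀ k} (hu : IsSymm q t a u) (c : k) :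
    IsSymm q t a (c • u) := fun v => by
  rw [map_smul, pairing_smul, map_smul, LinearMap.smul_apply, hu]

theorem IsSymm.of_smul {n : ℕ} {u : (Fin n → ℕ) →₀ k} {c : k} (hc : c ≠ 0)
    (hu : IsSymm q t a (c • u)) : IsSymm q t a u := by
  have := hu.smul c⁻¹
  rwa [smul_smul, inv_mul_cancel₀ hc, one_smul] at this

theorem IsGeneric.isSymm_single (h : IsGeneric q t) (ha : IsGenericOver q t a)
    (α : Fin (m + 1) → ℕ) : IsSymm q t a (Finsupp.single α 1) := by
  induction α using composition_induction with
  | h0 =>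
    -- The polynomial at `0` is `1`, and every normalized polynomial is `1` at `a⁻¹τ`; both sides
    -- are the sum of the coefficients of `v`.
    intro v
    have : pairing q t a (1 : MvPolynomial (Fin (m + 1)) k) =
        (Finsupp.linearCombination k fun _ => (1 : k)) := by
      ext
      simp [pairing]
    have h0 : realize q t a (Finsupp.single (0 : Fin (m + 1) → ℕ) 1) = 1 := by
      simp [realize, normPrime, h.GPrime_zero]
    have h1 : (pairing q t a (realize q t a v)) (Finsupp.single (0 : Fin (m + 1) → ℕ) 1) =
        Finsupp.linearCombination k (fun _ => (1 : k)) v := by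
      have hb : barC q t (0 : Fin (m + 1) → ℕ) = bar q t 0 := by
        simp only [barC, Pi.zero_apply, Nat.cast_zero]
        rfl
      simp only [pairing, Finsupp.linearCombination_single, one_smul, hb]
      have : (aeval (a⁻¹ • bar q t 0) : MvPolynomial (Fin (m + 1)) k →ₐ[k] k).toLinearMap ∘ₗ
          realize q t a = Finsupp.linearCombination k fun _ => (1 : k) := by
        ext β
        have := h.eval_normPrime ha β
        simpa [realize, aeval_eq_eval] using this
      have := LinearMap.congr_fun this v
      simpa [aeval_eq_eval] using this
    rw [h0, this, h1]
  | hadj α i ih =>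
    by_cases hα : α i.castSucc = α i.succ
    · rwa [comp_adj_eq_self hα]
    have hA := h.diagCoeff_ne (v := fun j => (α j : ℤ)) (i := i) (by exact_mod_cast hα)
    have h1 := ih.of_isAdjoint (h.isAdjoint_hecke ha i) (h.isAdjoint_hecke ha i)
    rw [Finsupp.linearCombination_single, one_smul] at h1
    -- Removing the diagonal part from the image under `T_i` leaves the swapped basis vector with
    -- the nonzero coefficient `t - A`.
    refine IsSymm.of_smul hA ?_
    have := h1.sub (ih.smul (diagCoeff q t (fun j => (α j : ℤ)) i))
    rwa [add_sub_cancel_left] at this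
  | hrot α ih =>
    obtain ⟨w, hw⟩ := h.exists_isAdjoint_raiseInv (m := m) ha
    have h1 := ih.of_isAdjoint (h.isAdjoint_raisePrime ha) hw
    rw [Finsupp.linearCombination_single, one_smul] at h1
    refine IsSymm.of_smul ?_ h1
    have := ha.ne_barC α 0
    have ha0 := ha.1
    intro h0
    rw [sub_eq_zero, inv_mul_eq_one₀ ha0] at h0
    exact this h0

/-- Duality: the value of the normalized polynomial at `α` in `a⁻¹ γ̄` is symmetric in `α`, `γ`. -/
theorem IsGeneric.duality (h : IsGeneric q t) (ha : IsGenericOver q t a) {n : ℕ}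
    (α γ : Fin n → ℕ) : eval (a⁻¹ • barC q t γ) (normPrime q t a α) =
      eval (a⁻¹ • barC q t α) (normPrime q t a γ) := by
  cases n with
  | zero => rw [Subsingleton.elim α γ]
  | succ m => simpa [pairing, realize] using h.isSymm_single ha α (Finsupp.single γ 1)

end Duality

/-! ### The dual binomial formula over a field with generic parameters -/

section DualBinomial

variable {q t a : k} {n : ℕ}

variable (q t a) in
/-- The term `τ_β [α over β] G_β(a x) / G_β(a τ)`. -/
def binomTerm (α β : Fin n → ℕ) : MvPolynomial (Fin n) k :=
  (tauC q t β * binom q t α β * (eval (a • bar q t 0) (G q t β))⁻¹) • scale a (G q t β)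

theorem IsGeneric.binom_eq_zero (h : IsGeneric q t) {α β : Fin n → ℕ} (hle : size α ≤ size β)
    (hne : α ≠ β) : binom q t α β = 0 := by
  rw [binom, h.eval_G_of_ne hle hne, zero_div]

theorem IsGeneric.binom_self (h : IsGeneric q t) (α : Fin n → ℕ) : binom q t α α = 1 :=
  div_self (h.eval_G_ne_zero α)

/-- Written so that the dependence on `α` and `γ` is a symmetric product. -/
theorem eval_binomTerm (ha : a ≠ 0) (α β γ : Fin n → ℕ) :
    eval (a⁻¹ • barC q t γ) (binomTerm q t a α β) =
      tauC q t β * (eval (barC q t β) (G q t β))⁻¹ * (eval (a • bar q t 0) (G q t β))⁻¹ *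
        (eval (barC q t α) (G q t β) * eval (barC q t γ) (G q t β)) := by
  have : (fun i => a * (a⁻¹ • barC q t γ) i) = barC q t γ := by
    funext i
    simp [ha]
  rw [binomTerm, smul_eval, eval_scale, this, binom]
  ring

/-- The dual binomial formula, for generic parameters in any field. -/
theorem IsGeneric.dual_binomial (h : IsGeneric q t) (ha : IsGenericOver q t a) {N : ℕ}
    {s : Finset (Fin n → ℕ)} (hs : ∀ β, size β ≤ N → β ∈ s) (α : Fin n → ℕ) (hα : size α ≤ N) :
    normPrime q t a α = ∑ β ∈ s, binomTerm q t a α β := by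
  induction hd : size α using Nat.strong_induction_on generalizing α with
  | _ d ih =>
  have ha0 := ha.1
  have hterm (β : Fin n → ℕ) : (binomTerm q t a α β).totalDegree ≤ d := by
    by_cases hβ : size β ≤ d
    · exact totalDegree_smul_le_of_le ((totalDegree_scale_le _ _).trans
        ((h.totalDegree_G_le β).trans hβ)) _
    · rw [binomTerm, h.binom_eq_zero (by omega) (by rintro rfl; omega)]
      simp
  have hdeg : (normPrime q t a α - ∑ β ∈ s, binomTerm q t a α β).totalDegree ≤ d :=
    totalDegree_sub_le_of_le (totalDegree_smul_le_of_le (hd ▸ h.totalDegree_GPrime_le α) _)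
      (totalDegree_finsetSum_le fun β _ => hterm β)
  -- Only `β = α` reaches degree `d`; its coefficient `τ_α a^d / G_α(aτ)` is `1 / G'_α(a⁻¹τ)` by the
  -- normalization identity.
  have htop : homogeneousComponent d (normPrime q t a α - ∑ β ∈ s, binomTerm q t a α β) = 0 := by
    obtain ⟨n1, n2, n3⟩ := h.normalization ha α
    rw [map_sub, map_sum, Finset.sum_eq_single α, sub_eq_zero, binomTerm, h.binom_self, mul_one,
      map_smul, homogeneousComponent_scale, normPrime, map_smul, ← hd, h.top_GPrime,
      ← smul_eq_C_mul, smul_smul]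
    · congr 1
      rw [n3] at n1 ⊢
      have := left_ne_zero_of_mul (left_ne_zero_of_mul n1)
      field_simp
    · intro β _ hβ
      by_cases hsize : size α ≤ size β
      · rw [binomTerm, h.binom_eq_zero hsize hβ.symm]
        simp
      · refine (totalDegree_le_iff (d := size β)).1 ?_ d (by omega)
        exact totalDegree_smul_le_of_le ((totalDegree_scale_le _ _).trans (h.totalDegree_G_le β)) _
    · exact fun hn => absurd (hs α hα) hn
  rw [← sub_eq_zero]
  refine scale_injective (inv_ne_zero ha0) (h.eq_zero_of_barC (d := d) (B := {β | size β = d})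
    (fun _ hβ => hβ) ((totalDegree_scale_le _ _).trans hdeg) ?_ ?_)
  · intro β hβ
    rw [coeff_scale, homogeneousComponent_eq_iff.1 (htop.trans (map_zero _).symm) β hβ, coeff_zero,
      mul_zero]
  · intro γ hγ hγd
    have hlt : size γ < d := lt_of_le_of_ne hγ hγd
    rw [eval_scale]
    change eval (a⁻¹ • barC q t γ) _ = 0
    -- Duality moves the value to the polynomial of the smaller `γ`, whose expansion is known; the
    -- terms then match by symmetry.
    rw [map_sub, h.duality ha, ih (size γ) hlt γ (by omega) rfl, map_sum, map_sum, sub_eq_zero]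
    refine Finset.sum_congr rfl fun β _ => ?_
    rw [eval_binomTerm ha0, eval_binomTerm ha0, mul_comm (eval (barC q t γ) _)]

end DualBinomial

/-! ### Base change and genericity of the indeterminates -/

section BaseChange

variable {K : Type*} [Field K] (φ : k →+* K) {q t : k} {n : ℕ}

theorem map_bar (v : Fin n → ℤ) (i : Fin n) : φ (bar q t v i) = bar (φ q) (φ t) v i := by
  simp [bar]

theorem eval_map_bar (v : Fin n → ℤ) (p : MvPolynomial (Fin n) k) :
    eval (bar (φ q) (φ t) v) (map φ p) = φ (eval (bar q t v) p) := by
  rw [eval_map, ← eval₂_id, hom_eval₂]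
  congr 1
  funext i
  exact (map_bar φ v i).symm

theorem IsGeneric.map (h : IsGeneric q t) : IsGeneric (φ q) (φ t) := by
  obtain ⟨ψ, hψ, rfl, rfl⟩ := h
  exact ⟨φ.comp ψ, φ.injective.comp hψ, rfl, rfl⟩

/-- The defining conditions survive a field extension, and uniqueness holds in the larger field. -/
theorem IsGeneric.map_G (h : IsGeneric q t) (α : Fin n → ℕ) :
    MvPolynomial.map φ (G q t α) = G (φ q) (φ t) α := by
  obtain ⟨h1, h2, h3⟩ := h.isInterpolation_G α
  refine ((h.map φ).existsUnique_isInterpolation α).unique ⟨?_, fun β hβ hne => ?_, ?_⟩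
    ((h.map φ).isInterpolation_G α)
  · exact (Finset.sup_mono (support_map_subset φ _)).trans h1
  · rw [barC, eval_map_bar, ← barC, h2 β hβ hne, map_zero]
  · rw [coeff_map, h3, map_one]

theorem IsGeneric.map_GPrime (h : IsGeneric q t) (α : Fin n → ℕ) :
    MvPolynomial.map φ (GPrime q t α) = GPrime (φ q) (φ t) α := by
  obtain ⟨h1, h2, h3⟩ := h.isPrimedInterpolation_GPrime α
  refine ((h.map φ).existsUnique_isPrimedInterpolation α).unique ⟨?_, ?_, fun β hβ => ?_⟩
    ((h.map φ).isPrimedInterpolation_GPrime α)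
  · exact (Finset.sup_mono (support_map_subset φ _)).trans h1
  · rw [← h.map_G, homogeneousComponent_eq_iff]
    intro β hβ
    rw [coeff_map, coeff_map, homogeneousComponent_eq_iff.1 h2 β hβ]
  · rw [tildeC, eval_map_bar, ← tildeC, h3 β hβ, map_zero]

theorem IsGeneric.map_binom (h : IsGeneric q t) (α β : Fin n → ℕ) :
    φ (binom q t α β) = binom (φ q) (φ t) α β := by
  rw [binom, binom, map_div₀, ← h.map_G]
  simp only [barC, eval_map_bar]

theorem map_tauC (α : Fin n → ℕ) : φ (tauC q t α) = tauC (φ q) (φ t) α := by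
  simp [tauC]

theorem isGeneric_qVar_tVar : IsGeneric qVar tVar :=
  ⟨algebraMap _ _, IsFractionRing.injective _ _, rfl, rfl⟩

/-- Monomials in `q` and `t` are constants of the rational function field in `a`. -/
theorem isGenericOver_aVar : IsGenericOver (algebraMap BaseField BigField qVar)
    (algebraMap BaseField BigField tVar) aVar := by
  refine ⟨RatFunc.X_ne_zero, fun i j h => ?_⟩
  rw [← map_zpow₀, ← map_zpow₀, ← map_mul, aVar, RatFunc.algebraMap_eq_C, ← RatFunc.algebraMap_X,
    ← RatFunc.algebraMap_C] at h
  exact Polynomial.X_ne_C _ (RatFunc.algebraMap_injective _ h)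

end BaseChange

/-! ### Translation to `ℚ(q, t, a)` -/

section Main

variable {n : ℕ}

theorem GNorm_eq (α : Fin n → ℕ) : GNorm α = eval (aVar •
    bar (algebraMap BaseField BigField qVar) (algebraMap BaseField BigField tVar) 0)
    (G (algebraMap BaseField BigField qVar) (algebraMap BaseField BigField tVar) α) := by
  rw [bar_zero, ← isGeneric_qVar_tVar.map_G]
  rfl

theorem GPrimeNorm_eq (α : Fin n → ℕ) : GPrimeNorm α = eval (aVar⁻¹ •
    bar (algebraMap BaseField BigField qVar) (algebraMap BaseField BigField tVar) 0)
    (GPrime (algebraMap BaseField BigField qVar) (algebraMap BaseField BigField tVar) α) := by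
  rw [bar_zero, ← isGeneric_qVar_tVar.map_GPrime]
  rfl

theorem KPrimePoly_eq (α : Fin n → ℕ) : KPrimePoly α = normPrime
    (algebraMap BaseField BigField qVar) (algebraMap BaseField BigField tVar) aVar α := by
  rw [KPrimePoly, normPrime, smul_eq_C_mul, GPrimeNorm_eq, GPrimeBig,
    isGeneric_qVar_tVar.map_GPrime]

theorem dualTerm_eq (α β : Fin n → ℕ) : dualTerm α β = binomTerm
    (algebraMap BaseField BigField qVar) (algebraMap BaseField BigField tVar) aVar α β := by
  have h (p : MvPolynomial (Fin n) BigField) : dilate p = scale aVar p := rfl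
  rw [dualTerm, binomTerm, h, KPoly, GNorm_eq, GBig, isGeneric_qVar_tVar.map_G, ← smul_eq_C_mul,
    ← smul_eq_C_mul, map_smul, smul_smul, map_mul, map_tauC, isGeneric_qVar_tVar.map_binom]

theorem support_dualTerm_subset (α : Fin n → ℕ) :
    Function.support (dualTerm α) ⊆ {β | size β ≤ size α} := by
  intro β hβ
  by_contra hlt
  simp only [Set.mem_ofPred_eq, not_le] at hlt
  refine hβ ?_
  rw [dualTerm, isGeneric_qVar_tVar.binom_eq_zero hlt.le (by rintro rfl; exact lt_irrefl _ hlt)]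
  simp

theorem finite_size_le (d : ℕ) : {β : Fin n → ℕ | size β ≤ d}.Finite :=
  Set.finite_coe_iff.1 (inferInstanceAs (Finite (Bounded n d)))

end Main

end

end InterpolationMacdonald

end

theorem mainTheorem5 (n : ℕ) :
    -- the polynomials are well defined, and no denominator vanishes
    (∀ α : Fin n → ℕ,
      (∃! p : MvPolynomial (Fin n) InterpolationMacdonald.BaseField,
        InterpolationMacdonald.IsInterpolation
          InterpolationMacdonald.qVar InterpolationMacdonald.tVar α p) ∧
      (∃! p : MvPolynomial (Fin n) InterpolationMacdonald.BaseField,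
        InterpolationMacdonald.IsPrimedInterpolation
          InterpolationMacdonald.qVar InterpolationMacdonald.tVar α p) ∧
      MvPolynomial.eval
        (InterpolationMacdonald.barC
          InterpolationMacdonald.qVar InterpolationMacdonald.tVar α)
        (InterpolationMacdonald.G
          InterpolationMacdonald.qVar InterpolationMacdonald.tVar α) ≠ 0 ∧
      InterpolationMacdonald.GNorm α ≠ 0 ∧
      InterpolationMacdonald.GPrimeNorm α ≠ 0) ∧
    -- the dual binomial formula, whose sum over all compositions is finite
    ∀ α : Fin n → ℕ,
      (Function.support fun β : Fin n → ℕ => InterpolationMacdonald.dualTerm α β).Finite ∧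
      InterpolationMacdonald.KPrimePoly α =
        ∑ᶠ β : Fin n → ℕ, InterpolationMacdonald.dualTerm α β := by
  have hq := InterpolationMacdonald.isGeneric_qVar_tVar
  have hb := hq.map (algebraMap InterpolationMacdonald.BaseField InterpolationMacdonald.BigField)
  have ha := InterpolationMacdonald.isGenericOver_aVar
  refine ⟨fun α => ⟨hq.existsUnique_isInterpolation α, hq.existsUnique_isPrimedInterpolation α,
    hq.eval_G_ne_zero α, ?_, ?_⟩, fun α => ?_⟩
  · rw [InterpolationMacdonald.GNorm_eq]
    exact (hb.normalization ha α).1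
  · rw [InterpolationMacdonald.GPrimeNorm_eq]
    exact (hb.normalization ha α).2.1
  · have hfin := InterpolationMacdonald.finite_size_le (n := n) (InterpolationMacdonald.size α)
    have hsub := InterpolationMacdonald.support_dualTerm_subset α
    refine ⟨hfin.subset hsub, ?_⟩
    rw [finsum_eq_sum_of_support_subset (s := hfin.toFinset) _ (by simpa using hsub),
      InterpolationMacdonald.KPrimePoly_eq,
      hb.dual_binomial ha (N := InterpolationMacdonald.size α)
        (fun β hβ => hfin.mem_toFinset.2 hβ) α le_rfl]
    exact Finset.sum_congr rfl fun β _ => (InterpolationMacdonald.dualTerm_eq α β).symm
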